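/- Let $G$ be a finite metabelian $3$-group with abelianization $G/G'$ of type $(3,3)$, nilpotency class $c$ and coclass $r=\log_3|G|-c\ge 2$. Let $\gamma_1(G)=G$, $\gamma_{j+1}(G)=[\gamma_j(G),G]$ be its lower central series, and $\zeta_0(G)=1$, $\zeta_j(G)/\zeta_{j-1}(G)=Z(G/\zeta_{j-1}(G))$ its upper central series. For $j\ge 1$ let the two-step centralizer $\chi_j(G)$ be the largest subgroup with $\gamma_2(G)\le\chi_j(G)\le G$ and $[\chi_j(G),\gamma_j(G)]\le\gamma_{j+2}(G)$. Put $s=\min\{j\ge 2:\chi_j(G)>\gamma_2(G)\}$ and $e=\min\{j\ge 2:\gamma_{j+1}(G)/\gamma_{j+2}(G)\text{ is cyclic}\}$, and assume that $G$ has defect of commutativity $k(G)=0$, that is, $[\chi_s(G),\gamma_e(G)]=\gamma_{c+1}(G)=1$. Let $G=\langle x,y\rangle$, put $s_2=t_2=[y,x]$, $s_j=[s_{j-1},x]$ and $t_j=[t_{j-1},y]$ for $j\ge 3$, and $\Sigma_j=\langle s_j,\ldots,s_c\rangle$, $T_\ell=\langle t_\ell,\ldots,t_{r+2}\rangle$ for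 $j,\ell\ge 3$. Assume that $x,y$ are chosen such that $\Sigma_3\cap T_3=1$ and $t_{r+2}=1$, and let $P_{j,\ell}=\Sigma_j\times T_\ell$ (internal direct product in $G'$) for $3\le j\le c+1$, $3\le\ell\le r+2$. Then: Two-step centralizers: $\chi_j(G)=G'$ for $1\le j\le r$, $\chi_j(G)=\langle y,G'\rangle$ for $r+1\le j\le c-1$, and $\chi_j(G)=G$ for $j\ge c$. If $c=r+1$, then no maximal subgroup of $G$ occurs as a two-step centralizer $\chi_j(G)$, $j\ge 1$. (1) $\gamma_j(G)/\gamma_{j+1}(G)$ is of type $(3,3)$ for $j=1$ and for $3\le j\le r+1$, and is cyclic of order $3$ for $j=2$ and for $r+2\le j\le c$. (2) $\gamma_1(G)=\langle x,y,G'\rangle$, $\gamma_2(G)=\langle s_2,\gamma_3(G)\rangle$, $\gamma_j(G)=P_{j,j}$ for $3\le j\le r+1$, and $\gamma_j(G)=\Sigma_j$ for $r+2\le j\le c$. (3) $\zeta_j(G)/\zeta_{j-1}(G)$ is of type $(3,3)$ for $1\le j\le r-1$ and for $j=c$, and is cyclic of order $3$ for $r\le j\le c-1$. (4) $\zeta_j(G)=P_{c+1-j,\,r+2-j}$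 for $1\le j\le r-1$, $\zeta_j(G)=P_{c+1-j,\,3}$ for $r\le j\le c-2$, $\zeta_{c-1}(G)=\langle s_2,\zeta_{c-2}(G)\rangle$, and $\zeta_c(G)=\langle x,y,\zeta_{c-1}(G)\rangle$. -/

import Mathlib

open scoped commutatorElement

namespace CentralSeries

variable (G : Type*) [Group G]

/-- The lower central series `γ₁ = G`, `γ_{j+1} = [γ_j, G]`, numbered from `1`
(the index `0` is not used; it also gives `G`). -/
abbrev gam (j : ℕ) : Subgroup G := (⊤ : Subgroup G).lowerCentralSeries (j - 1)

/-- The upper central series `ζ₀ = 1`, `ζ_{j+1}/ζ_j = Z(G/ζ_j)`. -/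
abbrev zet (j : ℕ) : Subgroup G := Subgroup.upperCentralSeries G j

/-- The coclass `log_p |G| - cl(G)` of a finite `p`-group `G`. -/
noncomputable def coclass (p : ℕ) : ℕ := Nat.log p (Nat.card G) - Group.nilpotencyClass G

/-- The `j`th two-step centralizer: the largest subgroup `γ₂ ≤ H ≤ G`
with `[H, γ_j] ≤ γ_{j+2}`. -/
def twoStepCentralizer (j : ℕ) : Subgroup G :=
  sSup {H : Subgroup G | gam G 2 ≤ H ∧ ⁅H, gam G j⁆ ≤ gam G (j + 2)}

/-- The invariant `s`: the least `j ≥ 2` with `χ_j > γ₂`. -/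
noncomputable def invS : ℕ :=
  sInf {j : ℕ | 2 ≤ j ∧ gam G 2 < twoStepCentralizer G j}

/-- The invariant `e`: the least `j ≥ 2` with `γ_{j+1}/γ_{j+2}` cyclic. -/
noncomputable def invE : ℕ :=
  sInf {j : ℕ | 2 ≤ j ∧ IsCyclic (gam G (j + 1) ⧸ (gam G (j + 2)).subgroupOf (gam G (j + 1)))}

/-- `G` has defect of commutativity `k`, that is `0 ≤ k ≤ 1` and `[χ_s, γ_e] = γ_{c+1-k}`,
where `c` is the nilpotency class. -/
def HasDefect (k : ℕ) : Prop :=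
  k ≤ 1 ∧ ⁅twoStepCentralizer G (invS G), gam G (invE G)⁆ =
    gam G (Group.nilpotencyClass G + 1 - k)

variable {G}

/-- The iterated commutators `u, [u, g], [[u, g], g], …`. -/
def iterComm (u g : G) : ℕ → G
  | 0 => u
  | n + 1 => ⁅iterComm u g n, g⁆

/-- `s₂ = [y, x]` and `s_j = [s_{j-1}, x]` for `j ≥ 3` (used for `j ≥ 2` only). -/
def sElt (x y : G) (j : ℕ) : G := iterComm ⁅y, x⁆ x (j - 2)

/-- `t₂ = [y, x]` and `t_l = [t_{l-1}, y]` for `l ≥ 3` (used for `l ≥ 2` only). -/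
def tElt (x y : G) (l : ℕ) : G := iterComm ⁅y, x⁆ y (l - 2)

/-- `Σ_j = ⟨s_j, …, s_c⟩`, where `c` is the nilpotency class. -/
def SigmaSub (x y : G) (j : ℕ) : Subgroup G :=
  Subgroup.closure {g | ∃ i, j ≤ i ∧ i ≤ Group.nilpotencyClass G ∧ g = sElt x y i}

/-- `T_l = ⟨t_l, …, t_{r+2}⟩`, where `r` is the coclass of the `p`-group `G`. -/
def TSub (p : ℕ) (x y : G) (l : ℕ) : Subgroup G :=
  Subgroup.closure {g | ∃ i, l ≤ i ∧ i ≤ coclass G p + 2 ∧ g = tElt x y i}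

/-- `P_{j,l} = Σ_j T_l`. The product is direct (in an abelian group `G'`)
as soon as `Σ₃ ∩ T₃ = 1`, since `j, l ≥ 3`. -/
def PSub (p : ℕ) (x y : G) (j l : ℕ) : Subgroup G := SigmaSub x y j ⊔ TSub p x y l

end CentralSeries

/-! Since `G` is metabelian with two generators, `G'` is a cyclic module over the group ring of
`G/G'`, generated by `s₂ = [y, x]`. It is therefore a copy of a commutative ring `A`, the image of
that group ring in `End(G')` (`exists_commutatorModel`). Let `X`, `Y` be `1` minus the actions of
`x`, `y`, and `I = (X, Y)`. Then `γ_{k+2}` corresponds to `I^k`, `s_{k+2}` to `X^k`, `t_{k+2}` to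
`Y^k`, and up to index `c - 2` the term `ζ_j` is the annihilator of `I^j`. Everything becomes a
question about powers of `I` and their annihilators; throughout `c = n + 2` and `r = d + 1`, so `I^n
≠ 0 = I^(n+1)`.

The cubes of `x` and `y` lie in `G'` and impose relations on `A` (`ExtensionRelations`). When `I/I²`
and `I²/I³` are not cyclic, these yield `XY ≡ pX²`, `XY ≡ qY²` or `X² ≡ Y²` mod `I³`
(`exists_quadratic_relation`), so noncyclic factors need only two generators. Defect `0` makes a
linear form kill a power of `I`, so once a factor is cyclic all later ones are. Comparing the
resulting order of `A` with the coclass (`ExtensionRelations.card_eq`) yields `e = r + 1`, and then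
`t_{r+2} = 1` forces `Y I^d = 0`.

Independence of the `s_j` and `t_j` excludes `X² ≡ Y²` for `d ≥ 2`. Hence `I^k` is additively
spanned by the `X^i` and `Y^i` with `i ≥ k` (`toAddSubgroup_pow`), which settles the lower central
series. The annihilator of `I^j` is spanned by `X^i`, `i ≥ n + 1 - j`, and `Y^i`, `i ≥ max(1, d + 1
- j)` (`mem_upperTerm_iff`). That these elements annihilate rests on the depth estimate
`left_mul_right_pow_mem`; the converse is a descent with coefficients mod `3`
(`mem_upperTerm_of_mul_eq_zero`). -/

namespace CentralSeries

/-! ### Index-three steps between additive subgroups. -/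

section Index

/-- Adjoining an element `g ∉ B` with `3g ∈ B` to `B` gives an overgroup of index `3`. -/
theorem relIndex_sup_zmultiples_eq_three {A : Type*} [AddCommGroup A] {B : AddSubgroup A} {g : A}
    (hg : g ∉ B) (h3 : (3 : ℕ) • g ∈ B) :
    B.relIndex (B ⊔ AddSubgroup.zmultiples g) = 3 := by
  rw [AddSubgroup.relIndex_sup_left]
  have hle : B.relIndex (AddSubgroup.zmultiples g) ∣ 3 := by
    let K : AddSubgroup (AddSubgroup.zmultiples g) := B.addSubgroupOf (AddSubgroup.zmultiples g)
    have : K.index ∣ 3 := by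
      rw [AddSubgroup.index_eq_card]
      let g' : AddSubgroup.zmultiples g := ⟨g, AddSubgroup.mem_zmultiples g⟩
      have hgen : AddSubgroup.zmultiples (QuotientAddGroup.mk' K g') = ⊤ := by
        rw [eq_top_iff]
        rintro q -
        obtain ⟨⟨z, hz⟩, rfl⟩ := QuotientAddGroup.mk'_surjective K q
        obtain ⟨m, rfl⟩ := AddSubgroup.mem_zmultiples_iff.1 hz
        refine AddSubgroup.mem_zmultiples_iff.2 ⟨m, ?_⟩
        rw [← map_zsmul]
        rfl
      have hc : Nat.card (AddSubgroup.zmultiples (QuotientAddGroup.mk' K g')) =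
          Nat.card (AddSubgroup.zmultiples g ⧸ K) := by
        rw [hgen]; exact Nat.card_congr AddSubgroup.topEquiv.toEquiv
      rw [← hc, Nat.card_zmultiples]
      apply addOrderOf_dvd_of_nsmul_eq_zero
      rw [← map_nsmul, QuotientAddGroup.mk'_apply, QuotientAddGroup.eq_zero_iff]
      exact h3
    exact this
  rcases (Nat.dvd_prime Nat.prime_three).1 hle with h | h
  · exact absurd (AddSubgroup.relIndex_eq_one.1 h (AddSubgroup.mem_zmultiples g)) hg
  · exact h

theorem mem_sup_zmultiples_iff {A : Type*} [AddCommGroup A] {B : AddSubgroup A} {g z : A} :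
    z ∈ B ⊔ AddSubgroup.zmultiples g ↔ ∃ m : ℤ, z - m • g ∈ B := by
  constructor
  · intro h
    obtain ⟨u, hu, v, hv, rfl⟩ := AddSubgroup.mem_sup.1 h
    obtain ⟨m, rfl⟩ := AddSubgroup.mem_zmultiples_iff.1 hv
    exact ⟨m, by simpa using hu⟩
  · rintro ⟨m, hm⟩
    exact AddSubgroup.mem_sup.2 ⟨_, hm, m • g, AddSubgroup.zsmul_mem_zmultiples g m, by simp⟩

end Index

/-! ### Powers of the ideal `I = (X, Y)` and cyclicity of their factors. -/

section AugIdeal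

variable {A : Type*} [CommRing A] {X Y : A}

/-- The ideal generated by `X` and `Y`. -/
abbrev augIdeal (X Y : A) : Ideal A := Ideal.span {X, Y}

theorem left_mem_augIdeal : X ∈ augIdeal X Y := Ideal.subset_span (by simp)

theorem right_mem_augIdeal : Y ∈ augIdeal X Y := Ideal.subset_span (by simp)

theorem mul_mem_augIdeal_pow {u v : A} {i j k : ℕ} (hu : u ∈ augIdeal X Y ^ i)
    (hv : v ∈ augIdeal X Y ^ j) (hk : k ≤ i + j) : u * v ∈ augIdeal X Y ^ k :=
  Ideal.pow_le_pow_right hk (by rw [pow_add]; exact Ideal.mul_mem_mul hu hv)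

theorem monomial_mem_augIdeal_pow {i j k : ℕ} (hk : k ≤ i + j) :
    X ^ i * Y ^ j ∈ augIdeal X Y ^ k :=
  mul_mem_augIdeal_pow (Ideal.pow_mem_pow left_mem_augIdeal i)
    (Ideal.pow_mem_pow right_mem_augIdeal j) hk

theorem left_pow_mem_augIdeal_pow {i k : ℕ} (hk : k ≤ i) : X ^ i ∈ augIdeal X Y ^ k :=
  Ideal.pow_le_pow_right hk (Ideal.pow_mem_pow left_mem_augIdeal i)

theorem right_pow_mem_augIdeal_pow {i k : ℕ} (hk : k ≤ i) : Y ^ i ∈ augIdeal X Y ^ k :=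
  Ideal.pow_le_pow_right hk (Ideal.pow_mem_pow right_mem_augIdeal i)

theorem left_mul_mem_augIdeal_pow {z : A} {k : ℕ} (hz : z ∈ augIdeal X Y ^ k) :
    X * z ∈ augIdeal X Y ^ (k + 1) :=
  mul_mem_augIdeal_pow (by simpa using left_mem_augIdeal (X := X) (Y := Y)) hz (i := 1) (by omega)

theorem right_mul_mem_augIdeal_pow {z : A} {k : ℕ} (hz : z ∈ augIdeal X Y ^ k) :
    Y * z ∈ augIdeal X Y ^ (k + 1) :=
  mul_mem_augIdeal_pow (by simpa using right_mem_augIdeal (X := X) (Y := Y)) hz (i := 1) (by omega)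

theorem augIdeal_pow_succ_le {k : ℕ} {J : Ideal A}
    (hX : ∀ z ∈ augIdeal X Y ^ k, X * z ∈ J) (hY : ∀ z ∈ augIdeal X Y ^ k, Y * z ∈ J) :
    augIdeal X Y ^ (k + 1) ≤ J := by
  rw [pow_succ', Ideal.mul_le]
  intro u hu v hv
  obtain ⟨p, q, rfl⟩ := Ideal.mem_span_pair.1 hu
  have : (p * X + q * Y) * v = p * (X * v) + q * (Y * v) := by ring
  rw [this]
  exact J.add_mem (J.mul_mem_left _ (hX v hv)) (J.mul_mem_left _ (hY v hv))

theorem augIdeal_pow_le_of_monomial {k : ℕ} {J : Ideal A}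
    (h : ∀ i j, i + j = k → X ^ i * Y ^ j ∈ J) : augIdeal X Y ^ k ≤ J := by
  induction k generalizing J with
  | zero =>
    have := h 0 0 rfl
    simp only [pow_zero, mul_one] at this
    rw [(Ideal.eq_top_iff_one J).2 this]
    exact le_top
  | succ k ih =>
    refine augIdeal_pow_succ_le (fun z hz => ?_) (fun z hz => ?_)
    · have := ih (J := Submodule.comap (LinearMap.mulLeft A X) J) (fun i j hij => by
        have := h (i + 1) j (by omega)
        simpa [pow_succ', mul_assoc] using this) hz
      simpa using this
    · have := ih (J := Submodule.comap (LinearMap.mulLeft A Y) J) (fun i j hij => by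
        have := h i (j + 1) (by omega)
        simpa [pow_succ', mul_left_comm] using this) hz
      simpa using this

/-- The factor `I^k / I^(k+1)` is cyclic. -/
def CycFactor (X Y : A) (k : ℕ) : Prop :=
  ∃ g ∈ augIdeal X Y ^ k, ∀ z ∈ augIdeal X Y ^ k, ∃ m : ℤ,
    z - m * g ∈ augIdeal X Y ^ (k + 1)

/-- Modulo the ideal `(X, Y)` every element is an integer. -/
def IntegralModAug (X Y : A) : Prop := ∀ z : A, ∃ m : ℤ, z - m ∈ augIdeal X Y

/-- Ring elements act on `I^k / I^(k+1)` as integers, so the elements of `I^k` lying in `B` form an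
ideal. This is what allows generation to be tested on monomials although `B` is only an additive
subgroup. -/
theorem augIdeal_pow_le_addSubgroup (hZ : IntegralModAug X Y) {k : ℕ} {B : AddSubgroup A}
    (h1 : ∀ z ∈ augIdeal X Y ^ (k + 1), z ∈ B) (h : ∀ i j, i + j = k → X ^ i * Y ^ j ∈ B) :
    ∀ z ∈ augIdeal X Y ^ k, z ∈ B := by
  let J : Ideal A :=
    { carrier := {z | z ∈ augIdeal X Y ^ k ∧ z ∈ B}
      add_mem' := fun hu hv => ⟨Ideal.add_mem _ hu.1 hv.1, B.add_mem hu.2 hv.2⟩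
      zero_mem' := ⟨Ideal.zero_mem _, B.zero_mem⟩
      smul_mem' := by
        rintro p z ⟨hz, hzB⟩
        refine ⟨Ideal.mul_mem_left _ _ hz, ?_⟩
        obtain ⟨m, hm⟩ := hZ p
        have : p • z = m • z + (p - m) * z := by
          simp only [smul_eq_mul, zsmul_eq_mul]; ring
        rw [this]
        refine B.add_mem (B.zsmul_mem hzB m) (h1 _ ?_)
        exact mul_mem_augIdeal_pow (i := 1) (by simpa using hm) hz (by omega) }
  have : augIdeal X Y ^ k ≤ J := augIdeal_pow_le_of_monomial fun i j hij =>
    ⟨monomial_mem_augIdeal_pow (by omega), h i j hij⟩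
  exact fun z hz => (this hz).2

theorem cycFactor_of_monomial (hZ : IntegralModAug X Y) {k : ℕ} {g : A}
    (hg : g ∈ augIdeal X Y ^ k)
    (h : ∀ i j, i + j = k → ∃ m : ℤ, X ^ i * Y ^ j - m * g ∈ augIdeal X Y ^ (k + 1)) :
    CycFactor X Y k := by
  refine ⟨g, hg, fun z hz => ?_⟩
  have := augIdeal_pow_le_addSubgroup (B := (augIdeal X Y ^ (k + 1)).toAddSubgroup ⊔
    AddSubgroup.zmultiples g) hZ (fun z hz => AddSubgroup.mem_sup_left hz) (fun i j hij => by
      obtain ⟨m, hm⟩ := h i j hij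
      exact mem_sup_zmultiples_iff.2 ⟨m, by simpa using hm⟩) z hz
  obtain ⟨m, hm⟩ := mem_sup_zmultiples_iff.1 this
  exact ⟨m, by simpa using hm⟩

/-- `I` is nilpotent and the residue ring is a quotient of `𝔽₃`: an integer representing `z` mod `I`
must be prime to `3`, so a multiple of `z` is `1` minus a nilpotent. -/
theorem isUnit_of_notMem_augIdeal {N : ℕ} (hN : augIdeal X Y ^ N = ⊥)
    (hZ : IntegralModAug X Y) (h3 : (3 : A) ∈ augIdeal X Y) {z : A} (hz : z ∉ augIdeal X Y) :
    IsUnit z := by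
  have hnil : ∀ w ∈ augIdeal X Y, IsNilpotent w := fun w hw =>
    ⟨N, by simpa [hN] using Ideal.pow_mem_pow hw N⟩
  obtain ⟨m, hm⟩ := hZ z
  have hm3 : ¬ (3 : ℤ) ∣ m := by
    rintro ⟨l, rfl⟩
    apply hz
    have : z = (z - ((3 * l : ℤ) : A)) + l * 3 := by push_cast; ring
    rw [this]
    exact Ideal.add_mem _ hm (Ideal.mul_mem_left _ _ h3)
  have hcop : IsCoprime m 3 := by
    rw [Int.isCoprime_iff_gcd_eq_one, Int.gcd_comm]
    exact (Int.isCoprime_iff_gcd_eq_one.1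
      ((Int.prime_three.coprime_iff_not_dvd).2 hm3))
  obtain ⟨u, v, huv⟩ := hcop
  have hA : (u : A) * m + v * 3 = 1 := by exact_mod_cast congrArg (Int.cast : ℤ → A) huv
  have : (u : A) * z = 1 - (v * 3 - u * (z - m)) := by linear_combination hA
  have hun : IsUnit ((u : A) * z) := by
    rw [this]
    exact (hnil _ (Ideal.sub_mem _ (Ideal.mul_mem_left _ _ h3)
      (Ideal.mul_mem_left _ _ hm))).isUnit_one_sub
  exact isUnit_of_mul_isUnit_right hun

/-- Nakayama for a nilpotent ideal: the inclusion iterates until it reaches `I^N = 0`. -/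
theorem eq_bot_of_augIdeal_pow_le {N k : ℕ} (hN : augIdeal X Y ^ N = ⊥)
    (h : augIdeal X Y ^ k ≤ augIdeal X Y ^ (k + 1)) : augIdeal X Y ^ k = ⊥ := by
  have key : ∀ i, augIdeal X Y ^ k ≤ augIdeal X Y ^ (k + i) := by
    intro i
    induction i with
    | zero => exact le_rfl
    | succ i ih =>
      refine h.trans ?_
      rw [← add_assoc, pow_succ, pow_succ]
      exact Ideal.mul_mono_left ih
  exact le_bot_iff.1 ((key N).trans (hN ▸ Ideal.pow_le_pow_right (by omega)))

end AugIdeal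

/-! ### Additive spans of powers of one element, modelling `Σ_j` and `T_l`. -/

section PowSpan

variable {A : Type*} [CommRing A] {X : A}

/-- The additive subgroup generated by the powers `X^i` with `i ≥ k`. -/
def powSpan (X : A) (k : ℕ) : AddSubgroup A := AddSubgroup.closure {z | ∃ i, k ≤ i ∧ z = X ^ i}

theorem pow_mem_powSpan {i k : ℕ} (h : k ≤ i) : X ^ i ∈ powSpan X k :=
  AddSubgroup.subset_closure ⟨i, h, rfl⟩

theorem powSpan_le {k : ℕ} {B : AddSubgroup A} (h : ∀ i, k ≤ i → X ^ i ∈ B) :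
    powSpan X k ≤ B := by
  refine (AddSubgroup.closure_le B).2 ?_
  rintro _ ⟨i, hi, rfl⟩
  exact h i hi

theorem powSpan_anti {k l : ℕ} (h : k ≤ l) : powSpan X l ≤ powSpan X k :=
  powSpan_le fun _ hi => pow_mem_powSpan (h.trans hi)

theorem powSpan_eq_bot {k : ℕ} (h : X ^ k = 0) : powSpan X k = ⊥ :=
  le_bot_iff.1 (powSpan_le fun i hi => by
    rw [AddSubgroup.mem_bot, ← Nat.add_sub_of_le hi, pow_add, h, zero_mul])

theorem powSpan_eq_sup (k : ℕ) :
    powSpan X k = powSpan X (k + 1) ⊔ AddSubgroup.zmultiples (X ^ k) := by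
  apply le_antisymm
  · refine powSpan_le fun i hi => ?_
    rcases hi.eq_or_lt with rfl | hi
    · exact AddSubgroup.mem_sup_right (AddSubgroup.mem_zmultiples _)
    · exact AddSubgroup.mem_sup_left (pow_mem_powSpan hi)
  · refine sup_le (powSpan_anti (by omega)) ?_
    rw [AddSubgroup.zmultiples_le]
    exact pow_mem_powSpan le_rfl

theorem exists_sub_mem_powSpan {k : ℕ} {z : A} (hz : z ∈ powSpan X k) :
    ∃ m : ℤ, z - m * X ^ k ∈ powSpan X (k + 1) := by
  rw [powSpan_eq_sup, mem_sup_zmultiples_iff] at hz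
  simpa using hz

theorem pow_mul_mem_of_mem_powSpan {B : AddSubgroup A} {u : A} {k : ℕ}
    (h : ∀ i, k ≤ i → u * X ^ i ∈ B) {z : A} (hz : z ∈ powSpan X k) : u * z ∈ B := by
  have : powSpan X k ≤ B.comap (AddMonoidHom.mulLeft u) := powSpan_le fun i hi => h i hi
  exact this hz

theorem pow_mul_mem_powSpan {k m : ℕ} {z : A} (hz : z ∈ powSpan X k) :
    X ^ m * z ∈ powSpan X (k + m) :=
  pow_mul_mem_of_mem_powSpan (fun i hi => by
    rw [← pow_add]; exact pow_mem_powSpan (by omega)) hz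

theorem exists_eq_pow_mul_of_mem_powSpan {k : ℕ} {z : A} (hz : z ∈ powSpan X k) :
    ∃ w, z = X ^ k * w := by
  have : powSpan X k ≤ (Ideal.span {X ^ k}).toAddSubgroup := powSpan_le fun i hi =>
    Ideal.mem_span_singleton.2 (pow_dvd_pow X hi)
  exact Ideal.mem_span_singleton.1 (this hz)

theorem pow_notMem_powSpan_succ (hX : IsNilpotent X) {k : ℕ} (hk : X ^ k ≠ 0) :
    X ^ k ∉ powSpan X (k + 1) := by
  intro h
  obtain ⟨w, hw⟩ := exists_eq_pow_mul_of_mem_powSpan h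
  have hu : IsUnit (1 - X * w) := ((Commute.all X w).isNilpotent_mul_right hX).isUnit_one_sub
  apply hk
  rw [← hu.mul_left_inj, zero_mul]
  linear_combination hw

/-- The hypothesis says `(1 - X)³ = 1`, so `3X^k = 3X^(k+1) - X^(k+2)`: multiplication by `3` raises
depth. -/
theorem three_mul_pow_mem_powSpan (h3 : 3 * X - 3 * X ^ 2 + X ^ 3 = 0) {k : ℕ} (hk : 1 ≤ k) :
    3 * X ^ k ∈ powSpan X (k + 1) := by
  obtain ⟨k, rfl⟩ := Nat.exists_eq_add_of_le' hk
  have : 3 * X ^ (k + 1) = (3 : ℤ) • X ^ (k + 2) - X ^ (k + 3) := by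
    rw [zsmul_eq_mul]; push_cast; linear_combination X ^ k * h3
  rw [this]
  exact AddSubgroup.sub_mem _ (AddSubgroup.zsmul_mem _ (pow_mem_powSpan le_rfl) _)
    (pow_mem_powSpan (by omega))

theorem three_mul_pow_eq_zero (h3 : 3 * X - 3 * X ^ 2 + X ^ 3 = 0) {k : ℕ} (hk : 1 ≤ k)
    (h : X ^ (k + 1) = 0) : 3 * X ^ k = 0 := by
  simpa [powSpan_eq_bot h] using three_mul_pow_mem_powSpan h3 hk

theorem three_dvd_of_intCast_mul_eq_zero {g : A} (h3 : 3 * g = 0) (hg : g ≠ 0) {m : ℤ}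
    (hm : m * g = 0) : (3 : ℤ) ∣ m := by
  by_contra h
  obtain ⟨u, v, huv⟩ := (Int.prime_three.coprime_iff_not_dvd).2 h
  have hA : (u : A) * 3 + v * m = 1 := by exact_mod_cast congrArg (Int.cast : ℤ → A) huv
  exact hg (by linear_combination (-g) * hA + u * h3 + v * hm)

theorem intCast_mul_pow_mem_powSpan (h3 : 3 * X - 3 * X ^ 2 + X ^ 3 = 0) {k : ℕ} (hk : 1 ≤ k)
    {m : ℤ} (hm : (3 : ℤ) ∣ m) : m * X ^ k ∈ powSpan X (k + 1) := by
  obtain ⟨l, rfl⟩ := hm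
  have : ((3 * l : ℤ) : A) * X ^ k = l • (3 * X ^ k) := by
    rw [zsmul_eq_mul]; push_cast; ring
  rw [this]
  exact AddSubgroup.zsmul_mem _ (three_mul_pow_mem_powSpan h3 hk) _

/-- An element of `⟨X^k, X^(k+1), …⟩` killed by `X^m` has depth at least `n + 1 - m`,
where `n` is the last exponent with `X^n ≠ 0`. -/
theorem mem_powSpan_of_pow_mul_eq_zero (h3 : 3 * X - 3 * X ^ 2 + X ^ 3 = 0) {n m k : ℕ}
    (hn : 1 ≤ n) (hX : X ^ n ≠ 0) (hX' : X ^ (n + 1) = 0) (hk : 1 ≤ k) {z : A}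
    (hz : z ∈ powSpan X k) (hmz : X ^ m * z = 0) : z ∈ powSpan X (n + 1 - m) := by
  -- Depth is raised one step at a time. Multiplying by `X^(n-i)` kills everything deeper than `i`
  -- and turns the leading term into a multiple of `X^n`; since `z` is killed too, the leading
  -- coefficient is divisible by `3`. The alternative `i < k` covers indices below the starting
  -- depth.
  have key : ∀ i, i ≤ n + 1 - m → z ∈ powSpan X i ∨ i < k := by
    intro i
    induction i with
    | zero => exact fun _ => Or.inr (by omega)
    | succ i ih =>
      intro hi
      by_cases hik : i + 1 < k
      · exact Or.inr hik
      by_cases hik' : i + 1 = k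
      · exact Or.inl (hik' ▸ hz)
      left
      have hzi := (ih (by omega)).resolve_right (by omega)
      obtain ⟨l, hl⟩ := exists_sub_mem_powSpan hzi
      have h1 := pow_mul_mem_powSpan (m := n - i) hl
      rw [show i + 1 + (n - i) = n + 1 by omega, powSpan_eq_bot hX', AddSubgroup.mem_bot] at h1
      have h2 : X ^ (n - i) * z = 0 := by
        rw [show n - i = (n - i - m) + m by omega, pow_add, mul_assoc, hmz, mul_zero]
      have h4 : X ^ (n - i) * X ^ i = X ^ n := by rw [← pow_add]; congr 1; omega
      have h5 : (l : A) * X ^ n = 0 := by linear_combination h2 - h1 - l * h4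
      have h6 := three_dvd_of_intCast_mul_eq_zero (three_mul_pow_eq_zero h3 hn hX') hX h5
      have h7 := AddSubgroup.add_mem _ hl (intCast_mul_pow_mem_powSpan h3 (by omega) h6)
      simpa using h7
  by_cases h : n + 1 - m < k
  · exact powSpan_anti h.le hz
  · exact (key _ le_rfl).resolve_right h

end PowSpan

/-! ### Relations coming from the cubes of the generators. -/

section Relations

variable {A : Type*} [CommRing A] {X Y a b : A}

/-- The relations that the group extension imposes on the cyclic module `G'`, seen as a ring:
`1 - X` and `1 - Y` are the actions of the generators, `a` and `b` their cubes. -/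
structure ExtensionRelations (X Y a b : A) : Prop where
  integral : IntegralModAug X Y
  left_mul : X * a = 0
  right_mul : Y * b = 0
  left_norm : 3 - 3 * X + X ^ 2 = -(Y * a)
  right_norm : 3 - 3 * Y + Y ^ 2 = X * b

namespace ExtensionRelations

/-- This is the triviality of the action of `x³ ∈ G'` on the abelian group `G'`, recovered from the
two relations involving `a`. -/
theorem cube_left (h : ExtensionRelations X Y a b) : 3 * X - 3 * X ^ 2 + X ^ 3 = 0 := by
  linear_combination X * h.left_norm - Y * h.left_mul

theorem cube_right (h : ExtensionRelations X Y a b) : 3 * Y - 3 * Y ^ 2 + Y ^ 3 = 0 := by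
  linear_combination Y * h.right_norm + X * h.right_mul

theorem three_mem (h : ExtensionRelations X Y a b) : (3 : A) ∈ augIdeal X Y :=
  Ideal.mem_span_pair.2 ⟨3 - X, -a, by linear_combination -h.left_norm⟩

theorem three_mul_mem (h : ExtensionRelations X Y a b) {z : A} {k : ℕ}
    (hz : z ∈ augIdeal X Y ^ k) : 3 * z ∈ augIdeal X Y ^ (k + 1) :=
  mul_mem_augIdeal_pow (i := 1) (by simpa using h.three_mem) hz (by omega)

end ExtensionRelations

theorem mem_of_intCast_mul_mem {J : Ideal A} {z : A} {m : ℤ} (hm : ¬ (3 : ℤ) ∣ m)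
    (h3 : 3 * z ∈ J) (h : m * z ∈ J) : z ∈ J := by
  obtain ⟨u, v, huv⟩ := (Int.prime_three.coprime_iff_not_dvd).2 hm
  have hA : (u : A) * 3 + v * m = 1 := by exact_mod_cast congrArg (Int.cast : ℤ → A) huv
  have : z = u * (3 * z) + v * (m * z) := by linear_combination (-z) * hA
  rw [this]
  exact J.add_mem (J.mul_mem_left _ h3) (J.mul_mem_left _ h)

theorem mul_sub_mul_mem {u u' v v' : A} {i j k : ℕ} (hu : u ∈ augIdeal X Y ^ i)
    (huu : u - u' ∈ augIdeal X Y ^ (i + 1)) (hv : v' ∈ augIdeal X Y ^ j)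
    (hvv : v - v' ∈ augIdeal X Y ^ (j + 1)) (hk : k ≤ i + j + 1) :
    u * v - u' * v' ∈ augIdeal X Y ^ k := by
  have : u * v - u' * v' = u * (v - v') + (u - u') * v' := by ring
  rw [this]
  exact Ideal.add_mem _ (mul_mem_augIdeal_pow hu hvv (by omega))
    (mul_mem_augIdeal_pow huu hv (by omega))

theorem pow_sub_pow_mem {u v : A} {p : ℕ} (hu : u ∈ augIdeal X Y ^ p)
    (huv : u - v ∈ augIdeal X Y ^ (p + 1)) (i : ℕ) :
    u ^ i - v ^ i ∈ augIdeal X Y ^ (p * i + 1) := by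
  have hv : v ∈ augIdeal X Y ^ p := by
    have := Ideal.sub_mem _ hu (Ideal.pow_le_pow_right (Nat.le_succ p) huv)
    simpa using this
  induction i with
  | zero => simp
  | succ i ih =>
    rw [pow_succ u, pow_succ v]
    refine mul_sub_mul_mem (i := p * i) (j := p) (k := p * (i + 1) + 1) ?_ ih hv huv
      (by rw [mul_add]; omega)
    rw [pow_mul]
    exact Ideal.pow_mem_pow hu i

/-- Every element of `I` is congruent mod `I²` to an integral combination of `X` and `Y`. -/
theorem exists_linear_sub_mem (hZ : IntegralModAug X Y) {z : A} (hz : z ∈ augIdeal X Y) :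
    ∃ m l : ℤ, z - m * X - l * Y ∈ augIdeal X Y ^ 2 := by
  obtain ⟨p, q, rfl⟩ := Ideal.mem_span_pair.1 hz
  obtain ⟨m, hm⟩ := hZ p
  obtain ⟨l, hl⟩ := hZ q
  refine ⟨m, l, ?_⟩
  have : p * X + q * Y - m * X - l * Y = X * (p - m) + Y * (q - l) := by ring
  rw [this]
  exact Ideal.add_mem _ (left_mul_mem_augIdeal_pow (k := 1) (by simpa using hm))
    (right_mul_mem_augIdeal_pow (k := 1) (by simpa using hl))

/-- Coefficients in degree one matter only mod `3`; the representatives `0, ±1` make the later case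
analysis finite. -/
theorem exists_sub_mem_of_three (h3 : ∀ z ∈ augIdeal X Y, 3 * z ∈ augIdeal X Y ^ 2) (m : ℤ) :
    ∃ l : ℤ, (l = 0 ∨ l = 1 ∨ l = -1) ∧
      ∀ z ∈ augIdeal X Y, m * z - l * z ∈ augIdeal X Y ^ 2 := by
  have key : ∀ l t : ℤ, m = l + 3 * t →
      ∀ z ∈ augIdeal X Y, m * z - l * z ∈ augIdeal X Y ^ 2 := by
    rintro l t rfl z hz
    have : ((l + 3 * t : ℤ) : A) * z - l * z = t * (3 * z) := by push_cast; ring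
    rw [this]
    exact Ideal.mul_mem_left _ _ (h3 z hz)
  have h : m % 3 = 0 ∨ m % 3 = 1 ∨ m % 3 = 2 := by omega
  rcases h with h | h | h
  · exact ⟨0, by simp, key 0 (m / 3) (by omega)⟩
  · exact ⟨1, by simp, key 1 (m / 3) (by omega)⟩
  · exact ⟨-1, by simp, key (-1) (m / 3 + 1) (by omega)⟩

theorem cycFactor_one_of_left_mem (hZ : IntegralModAug X Y) (h : X ∈ augIdeal X Y ^ 2) :
    CycFactor X Y 1 := by
  refine cycFactor_of_monomial hZ (g := Y) (by simpa using right_mem_augIdeal) ?_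
  intro i j hij
  obtain ⟨rfl, rfl⟩ | ⟨rfl, rfl⟩ : (i = 0 ∧ j = 1) ∨ (i = 1 ∧ j = 0) := by omega
  · exact ⟨1, by simp⟩
  · exact ⟨0, by simpa using h⟩

theorem cycFactor_one_of_right_mem (hZ : IntegralModAug X Y) (h : Y ∈ augIdeal X Y ^ 2) :
    CycFactor X Y 1 := by
  refine cycFactor_of_monomial hZ (g := X) (by simpa using left_mem_augIdeal) ?_
  intro i j hij
  obtain ⟨rfl, rfl⟩ | ⟨rfl, rfl⟩ : (i = 0 ∧ j = 1) ∨ (i = 1 ∧ j = 0) := by omega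
  · exact ⟨0, by simpa using h⟩
  · exact ⟨1, by simp⟩

theorem cycFactor_two (hZ : IntegralModAug X Y) {g : A} (hg : g ∈ augIdeal X Y ^ 2)
    (h1 : ∃ m : ℤ, X ^ 2 - m * g ∈ augIdeal X Y ^ 3)
    (h2 : ∃ m : ℤ, X * Y - m * g ∈ augIdeal X Y ^ 3)
    (h3 : ∃ m : ℤ, Y ^ 2 - m * g ∈ augIdeal X Y ^ 3) : CycFactor X Y 2 := by
  refine cycFactor_of_monomial hZ hg ?_
  intro i j hij
  obtain ⟨rfl, rfl⟩ | ⟨rfl, rfl⟩ | ⟨rfl, rfl⟩ :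
    (i = 0 ∧ j = 2) ∨ (i = 1 ∧ j = 1) ∨ (i = 2 ∧ j = 0) := by omega
  · simpa using h3
  · simpa using h2
  · simpa using h1

namespace ExtensionRelations

/-- If `a` were congruent mod `I` to an integer prime to `3`, then `X a = 0` would put `X` into
`I²`, and `Y` alone would generate `I/I²`. -/
theorem left_cube_mem (h : ExtensionRelations X Y a b) (hc : ¬ CycFactor X Y 1) :
    a ∈ augIdeal X Y := by
  obtain ⟨m, hm⟩ := h.integral a
  by_cases hm3 : (3 : ℤ) ∣ m
  · obtain ⟨l, rfl⟩ := hm3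
    have : a = (a - ((3 * l : ℤ) : A)) + l * 3 := by push_cast; ring
    rw [this]
    exact Ideal.add_mem _ hm (Ideal.mul_mem_left _ _ h.three_mem)
  · refine absurd (cycFactor_one_of_left_mem h.integral (mem_of_intCast_mul_mem hm3 ?_ ?_)) hc
    · exact h.three_mul_mem (k := 1) (by simpa using left_mem_augIdeal)
    · have : (m : A) * X = -(X * (a - m)) := by linear_combination h.left_mul
      rw [this]
      exact Ideal.neg_mem_iff _ |>.2 (left_mul_mem_augIdeal_pow (k := 1) (by simpa using hm))

theorem right_cube_mem (h : ExtensionRelations X Y a b) (hc : ¬ CycFactor X Y 1) :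
    b ∈ augIdeal X Y := by
  obtain ⟨m, hm⟩ := h.integral b
  by_cases hm3 : (3 : ℤ) ∣ m
  · obtain ⟨l, rfl⟩ := hm3
    have : b = (b - ((3 * l : ℤ) : A)) + l * 3 := by push_cast; ring
    rw [this]
    exact Ideal.add_mem _ hm (Ideal.mul_mem_left _ _ h.three_mem)
  · refine absurd (cycFactor_one_of_right_mem h.integral (mem_of_intCast_mul_mem hm3 ?_ ?_)) hc
    · exact h.three_mul_mem (k := 1) (by simpa using right_mem_augIdeal)
    · have : (m : A) * Y = -(Y * (b - m)) := by linear_combination h.right_mul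
      rw [this]
      exact Ideal.neg_mem_iff _ |>.2 (right_mul_mem_augIdeal_pow (k := 1) (by simpa using hm))

theorem three_mem_sq (h : ExtensionRelations X Y a b) (hc : ¬ CycFactor X Y 1) :
    (3 : A) ∈ augIdeal X Y ^ 2 := by
  have : (3 : A) = 3 * X - X ^ 2 - Y * a := by linear_combination h.left_norm
  rw [this]
  refine Ideal.sub_mem _ (Ideal.sub_mem _ ?_ ?_) ?_
  · exact h.three_mul_mem (k := 1) (by simpa using left_mem_augIdeal)
  · exact left_pow_mem_augIdeal_pow le_rfl
  · exact right_mul_mem_augIdeal_pow (k := 1) (by simpa using h.left_cube_mem hc)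

/-- If the factors `I/I²` and `I²/I³` are not cyclic, then there is a quadratic relation mod `I³`
of one of three shapes. -/
theorem exists_quadratic_relation (h : ExtensionRelations X Y a b) (hc1 : ¬ CycFactor X Y 1)
    (hc2 : ¬ CycFactor X Y 2) :
    (∃ p : ℤ, X * Y - p * X ^ 2 ∈ augIdeal X Y ^ 3) ∨
      (∃ q : ℤ, X * Y - q * Y ^ 2 ∈ augIdeal X Y ^ 3) ∨
      X ^ 2 - Y ^ 2 ∈ augIdeal X Y ^ 3 := by
  have hlin : ∀ z ∈ augIdeal X Y, ∃ m l : ℤ, (m = 0 ∨ m = 1 ∨ m = -1) ∧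
      (l = 0 ∨ l = 1 ∨ l = -1) ∧ z - m * X - l * Y ∈ augIdeal X Y ^ 2 := by
    intro z hz
    have h3 : ∀ z ∈ augIdeal X Y, 3 * z ∈ augIdeal X Y ^ 2 := fun z hz =>
      h.three_mul_mem (k := 1) (by simpa using hz)
    obtain ⟨m, l, hml⟩ := exists_linear_sub_mem h.integral hz
    obtain ⟨m', hm', hm⟩ := exists_sub_mem_of_three h3 m
    obtain ⟨l', hl', hl⟩ := exists_sub_mem_of_three h3 l
    refine ⟨m', l', hm', hl', ?_⟩
    have := Ideal.add_mem _ (Ideal.add_mem _ hml (hm X left_mem_augIdeal))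
      (hl Y right_mem_augIdeal)
    convert this using 1
    ring
  obtain ⟨α, β, hα, hβ, ha⟩ := hlin a (h.left_cube_mem hc1)
  obtain ⟨γ, δ, hγ, hδ, hb⟩ := hlin b (h.right_cube_mem hc1)
  have hX2 : X ^ 2 ∈ augIdeal X Y ^ 2 := left_pow_mem_augIdeal_pow le_rfl
  have hY2 : Y ^ 2 ∈ augIdeal X Y ^ 2 := right_pow_mem_augIdeal_pow le_rfl
  have hXY : X * Y ∈ augIdeal X Y ^ 2 := by
    simpa using monomial_mem_augIdeal_pow (X := X) (Y := Y) (i := 1) (j := 1) le_rfl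
  have h3 := h.three_mem_sq hc1
  have hX3 : 3 * X ∈ augIdeal X Y ^ 3 := by
    rw [mul_comm]; exact left_mul_mem_augIdeal_pow h3
  have hY3 : 3 * Y ∈ augIdeal X Y ^ 3 := by
    rw [mul_comm]; exact right_mul_mem_augIdeal_pow h3
  -- The first two quadratic relations are `X a = 0` and `Y b = 0` with `a ≡ αX + βY` and `b ≡ γX +
  -- δY` mod `I²`.
  have r1 : α * X ^ 2 + β * (X * Y) ∈ augIdeal X Y ^ 3 := by
    have := Ideal.neg_mem_iff _ |>.2 (left_mul_mem_augIdeal_pow ha)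
    convert this using 1
    linear_combination h.left_mul
  have r2 : γ * (X * Y) + δ * Y ^ 2 ∈ augIdeal X Y ^ 3 := by
    have := Ideal.neg_mem_iff _ |>.2 (right_mul_mem_augIdeal_pow hb)
    convert this using 1
    linear_combination h.right_mul
  -- The third is the difference of the two norm relations; its linear terms `3X`, `3Y` drop out
  -- because `3 ∈ I²`.
  have r3 : (1 + γ) * X ^ 2 + (α + δ) * (X * Y) + (β - 1) * Y ^ 2 ∈ augIdeal X Y ^ 3 := by
    have := Ideal.sub_mem _ (Ideal.sub_mem _ hX3 hY3) (Ideal.add_mem _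
      (right_mul_mem_augIdeal_pow ha) (left_mul_mem_augIdeal_pow hb))
    convert this using 1
    linear_combination h.left_norm - h.right_norm
  have neg {z : A} (hz : z ∈ augIdeal X Y ^ 3) : -z ∈ augIdeal X Y ^ 3 :=
    Ideal.neg_mem_iff _ |>.2 hz
  by_cases hα0 : α = 0
  · by_cases hδ0 : δ = 0
    · subst hα0 hδ0
      simp only [Int.cast_zero, zero_mul, zero_add, add_zero] at r1 r2 r3
      rcases hβ with rfl | rfl | rfl
      · rcases hγ with rfl | rfl | rfl
        · exact Or.inr (Or.inr (by convert r3 using 1; push_cast; ring))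
        · exact Or.inl ⟨0, by convert r2 using 1; push_cast; ring⟩
        · exact Or.inl ⟨0, by convert neg r2 using 1; push_cast; ring⟩
      · exact Or.inl ⟨0, by convert r1 using 1; push_cast; ring⟩
      · exact Or.inl ⟨0, by convert neg r1 using 1; push_cast; ring⟩
    · subst hα0
      -- Here `δ = ±1` is its own inverse, so the second relation can be solved for `Y²`.
      have hY : Y ^ 2 + (δ * γ : ℤ) * (X * Y) ∈ augIdeal X Y ^ 3 := by
        rcases hδ with rfl | rfl | rfl
        · exact absurd rfl hδ0
        · convert r2 using 1; push_cast; ring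
        · convert neg r2 using 1; push_cast; ring
      refine Or.inr (Or.inl ⟨-(δ * γ), ?_⟩)
      by_contra hcon
      -- For `γ = 0` one has `Y² ∈ I³`, and the third relation expresses `X²` through `XY`, making
      -- `I²/I³` cyclic. For `γ = ±1` the relation just found is the desired one up to sign.
      rcases hγ with rfl | rfl | rfl
      · refine hc2 (cycFactor_two h.integral hXY ⟨-δ, ?_⟩ ⟨1, by simp⟩ ⟨0, ?_⟩)
        · have := Ideal.sub_mem _ r3 (Ideal.mul_mem_left _ ((β : A) - 1) hY)
          convert this using 1; push_cast; ring
        · convert hY using 1; push_cast; ring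
      · rcases hδ with rfl | rfl | rfl
        · exact hδ0 rfl
        · exact hcon (by convert hY using 1; push_cast; ring)
        · exact hcon (by convert neg hY using 1; push_cast; ring)
      · rcases hδ with rfl | rfl | rfl
        · exact hδ0 rfl
        · exact hcon (by convert neg hY using 1; push_cast; ring)
        · exact hcon (by convert hY using 1; push_cast; ring)
  · have hX : X ^ 2 + (α * β : ℤ) * (X * Y) ∈ augIdeal X Y ^ 3 := by
      rcases hα with rfl | rfl | rfl
      · exact absurd rfl hα0
      · convert r1 using 1; push_cast; ring
      · convert neg r1 using 1; push_cast; ring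
    refine Or.inl ⟨-(α * β), ?_⟩
    by_contra hcon
    rcases hβ with rfl | rfl | rfl
    · refine hc2 (cycFactor_two h.integral hXY ⟨0, ?_⟩ ⟨1, by simp⟩ ⟨α + δ, ?_⟩)
      · convert hX using 1; push_cast; ring
      · have := Ideal.sub_mem _ (Ideal.mul_mem_left _ ((1 : A) + γ) hX) r3
        convert this using 1; push_cast; ring
    · rcases hα with rfl | rfl | rfl
      · exact hα0 rfl
      · exact hcon (by convert hX using 1; push_cast; ring)
      · exact hcon (by convert neg hX using 1; push_cast; ring)
    · rcases hα with rfl | rfl | rfl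
      · exact hα0 rfl
      · exact hcon (by convert neg hX using 1; push_cast; ring)
      · exact hcon (by convert hX using 1; push_cast; ring)

end ExtensionRelations

end Relations

/-! ### Sizes of the factors `I^k / I^(k+1)` and the order of `A`. -/

section Factors

variable {A : Type*} [CommRing A] {X Y a b : A}

/-- A nonzero linear form in `X` and `Y` kills the factors `I^k / I^(k+1)` for `k ≥ d`. -/
def LinearFormKills (X Y : A) (d : ℕ) : Prop :=
  (∀ w ∈ augIdeal X Y ^ d, Y * w = 0) ∨
    ∃ v : ℤ, ∀ k, d ≤ k → ∀ w ∈ augIdeal X Y ^ k, X * w + v * (Y * w) ∈ augIdeal X Y ^ (k + 2)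

/-- If a linear form vanishes on the factors from degree `d` on, then `I^(k+1)` is, modulo
`I^(k+2)`, the product of `I^k` with a single variable: `X` if the form is `Y`, and `Y` if it is `X
+ vY`. Multiplication by that variable carries a generator to a generator. -/
theorem CycFactor.succ (hZ : IntegralModAug X Y) {d k : ℕ} (hd : LinearFormKills X Y d)
    (hk : d ≤ k) (hc : CycFactor X Y k) : CycFactor X Y (k + 1) := by
  obtain ⟨g, hg, hgen⟩ := hc
  rcases hd with hd | ⟨v, hv⟩
  · refine cycFactor_of_monomial hZ (left_mul_mem_augIdeal_pow hg) fun i j hij => ?_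
    rcases j with _ | j
    · obtain rfl : i = k + 1 := by omega
      obtain ⟨m, hm⟩ := hgen _ (left_pow_mem_augIdeal_pow le_rfl)
      refine ⟨m, ?_⟩
      convert left_mul_mem_augIdeal_pow hm using 1
      ring
    · refine ⟨0, ?_⟩
      have := hd (X ^ i * Y ^ j) (monomial_mem_augIdeal_pow (by omega))
      have h0 : X ^ i * Y ^ (j + 1) = 0 := by linear_combination this
      simp [h0]
  · refine cycFactor_of_monomial hZ (right_mul_mem_augIdeal_pow hg) fun i j hij => ?_
    rcases i with _ | i
    · obtain rfl : j = k + 1 := by omega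
      obtain ⟨m, hm⟩ := hgen _ (right_pow_mem_augIdeal_pow le_rfl)
      refine ⟨m, ?_⟩
      convert right_mul_mem_augIdeal_pow hm using 1
      ring
    · obtain ⟨m, hm⟩ := hgen (X ^ i * Y ^ j) (monomial_mem_augIdeal_pow (by omega))
      refine ⟨-v * m, ?_⟩
      have h1 := hv k hk (X ^ i * Y ^ j) (monomial_mem_augIdeal_pow (by omega))
      have h2 := Ideal.mul_mem_left _ (v : A) (right_mul_mem_augIdeal_pow hm)
      convert Ideal.sub_mem _ h1 h2 using 1
      push_cast
      ring

theorem cycFactor_zero (hZ : IntegralModAug X Y) : CycFactor X Y 0 :=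
  ⟨1, by simp, fun z _ => by simpa using hZ z⟩

theorem CycFactor.of_le (hZ : IntegralModAug X Y) {d k l : ℕ} (hd : LinearFormKills X Y d)
    (hk : d ≤ k) (hc : CycFactor X Y k) (hkl : k ≤ l) : CycFactor X Y l := by
  induction l, hkl using Nat.le_induction with
  | base => exact hc
  | succ l hl ih => exact ih.succ hZ hd (hk.trans hl)

theorem cycFactor_of_eq_bot {k : ℕ} (h : augIdeal X Y ^ k = ⊥) : CycFactor X Y k :=
  ⟨0, Ideal.zero_mem _, fun z hz => ⟨0, by
    rw [h, Ideal.mem_bot] at hz; simp [hz]⟩⟩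

/-- Next to a factor `X`, each `Y` may be exchanged for `pX`; this is why `i ≥ 1` is needed. -/
theorem left_pow_mul_right_pow_sub_mem {p : ℤ} (hp : X * Y - p * X ^ 2 ∈ augIdeal X Y ^ 3)
    {i j k : ℕ} (hi : 1 ≤ i) (hk : k ≤ i + j + 1) :
    X ^ i * Y ^ j - p ^ j * X ^ (i + j) ∈ augIdeal X Y ^ k := by
  obtain ⟨i, rfl⟩ := Nat.exists_eq_add_of_le' hi
  induction j generalizing k with
  | zero => simp
  | succ j ih =>
    have h1 := Ideal.mul_mem_left _ (p ^ j : A) (mul_mem_augIdeal_pow (X := X) (Y := Y)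
      (left_pow_mem_augIdeal_pow (le_refl (i + j))) hp (k := k) (by omega))
    have h2 := Ideal.pow_le_pow_right (show k ≤ i + 1 + j + 1 + 1 by omega)
      (right_mul_mem_augIdeal_pow (ih le_rfl))
    convert Ideal.add_mem _ h1 h2 using 1
    ring

theorem augIdeal_comm : augIdeal X Y = augIdeal Y X := by
  rw [augIdeal, augIdeal, Set.pair_comm]

theorem left_pow_mul_right_pow_sub_mem' {q : ℤ} (hq : X * Y - q * Y ^ 2 ∈ augIdeal X Y ^ 3)
    {i j k : ℕ} (hj : 1 ≤ j) (hk : k ≤ i + j + 1) :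
    X ^ i * Y ^ j - q ^ i * Y ^ (i + j) ∈ augIdeal X Y ^ k := by
  rw [augIdeal_comm] at hq ⊢
  rw [mul_comm X Y] at hq
  rw [mul_comm (X ^ i), add_comm i j]
  exact left_pow_mul_right_pow_sub_mem hq hj (by omega)

/-- If `X² ≡ Y²` mod `I³`, then even powers of `X` and `Y` agree up to higher order. -/
theorem left_pow_sub_right_pow_mem (hXY : X ^ 2 - Y ^ 2 ∈ augIdeal X Y ^ 3) {i k : ℕ}
    (hi : Even i) (hk : k ≤ i + 1) : X ^ i - Y ^ i ∈ augIdeal X Y ^ k := by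
  obtain ⟨i, rfl⟩ := hi
  have := pow_sub_pow_mem (p := 2) (left_pow_mem_augIdeal_pow le_rfl) hXY i
  rw [← pow_mul, ← pow_mul, two_mul] at this
  exact Ideal.pow_le_pow_right hk this

theorem left_pow_mul_right_pow_sub_mem_of_even (hXY : X ^ 2 - Y ^ 2 ∈ augIdeal X Y ^ 3)
    {i j k : ℕ} (hi : Even i) (hk : k ≤ i + j + 1) :
    X ^ i * Y ^ j - Y ^ (i + j) ∈ augIdeal X Y ^ k := by
  have := mul_mem_augIdeal_pow (X := X) (Y := Y) (right_pow_mem_augIdeal_pow (le_refl j))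
    (left_pow_sub_right_pow_mem hXY hi le_rfl) (k := k) (by omega)
  convert this using 1
  ring

/-- Noncyclic factors up to degree `k` force the factor of degree `k` to be generated by two
elements. -/
theorem ExtensionRelations.exists_two_generators (h : ExtensionRelations X Y a b) {k : ℕ}
    (hk : 1 ≤ k) (hc : ∀ i, 1 ≤ i → i ≤ k → ¬ CycFactor X Y i) :
    ∃ g ∈ augIdeal X Y ^ k, ∃ g' ∈ augIdeal X Y ^ k, ∀ i j, i + j = k →
      ∃ m l : ℤ, X ^ i * Y ^ j - m * g - l * g' ∈ augIdeal X Y ^ (k + 1) := by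
  rcases hk.eq_or_lt with rfl | hk2
  · refine ⟨X, by simpa using left_mem_augIdeal, Y, by simpa using right_mem_augIdeal, ?_⟩
    intro i j hij
    obtain ⟨rfl, rfl⟩ | ⟨rfl, rfl⟩ : (i = 0 ∧ j = 1) ∨ (i = 1 ∧ j = 0) := by omega
    · exact ⟨0, 1, by simp⟩
    · exact ⟨1, 0, by simp⟩
  · rcases h.exists_quadratic_relation (hc 1 le_rfl hk) (hc 2 (by omega) hk2) with
      ⟨p, hp⟩ | ⟨q, hq⟩ | hXY
    · refine ⟨X ^ k, left_pow_mem_augIdeal_pow le_rfl, Y ^ k, right_pow_mem_augIdeal_pow le_rfl,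
        fun i j hij => ?_⟩
      rcases Nat.eq_zero_or_pos i with rfl | hi
      · obtain rfl : j = k := by omega
        exact ⟨0, 1, by simp⟩
      · subst hij
        exact ⟨p ^ j, 0, by simpa using left_pow_mul_right_pow_sub_mem hp hi le_rfl⟩
    · refine ⟨X ^ k, left_pow_mem_augIdeal_pow le_rfl, Y ^ k, right_pow_mem_augIdeal_pow le_rfl,
        fun i j hij => ?_⟩
      rcases Nat.eq_zero_or_pos j with rfl | hj
      · obtain rfl : i = k := by omega
        exact ⟨1, 0, by simp⟩
      · subst hij
        exact ⟨0, q ^ i, by simpa using left_pow_mul_right_pow_sub_mem' hq hj le_rfl⟩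
    -- With `X² ≡ Y²` a monomial depends only on the parity of its exponent of `X`, so one
    -- representative of each parity suffices.
    · obtain ⟨k, rfl⟩ := Nat.exists_eq_add_of_le' hk
      refine ⟨X * Y ^ k, by
        simpa using monomial_mem_augIdeal_pow (X := X) (Y := Y) (i := 1) (j := k) (by omega),
        Y ^ (k + 1), right_pow_mem_augIdeal_pow le_rfl, fun i j hij => ?_⟩
      rcases Nat.even_or_odd' i with ⟨t, rfl | rfl⟩
      · refine ⟨0, 1, ?_⟩
        have := left_pow_mul_right_pow_sub_mem_of_even hXY (i := 2 * t) (j := j) (k := k + 1 + 1)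
          (by simp) (by omega)
        simpa [hij] using this
      · refine ⟨1, 0, ?_⟩
        have := left_mul_mem_augIdeal_pow (left_pow_mul_right_pow_sub_mem_of_even hXY (i := 2 * t)
          (j := j) (k := k + 1) (by simp) (by omega))
        rw [show 2 * t + j = k by omega] at this
        convert this using 1
        push_cast
        ring

theorem ExtensionRelations.relIndex_of_cycFactor (h : ExtensionRelations X Y a b) {N k : ℕ}
    (hN : augIdeal X Y ^ N = ⊥) (hk : augIdeal X Y ^ k ≠ ⊥) (hc : CycFactor X Y k) :
    (augIdeal X Y ^ (k + 1)).toAddSubgroup.relIndex (augIdeal X Y ^ k).toAddSubgroup = 3 := by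
  obtain ⟨g, hg, hgen⟩ := hc
  have heq : (augIdeal X Y ^ k).toAddSubgroup =
      (augIdeal X Y ^ (k + 1)).toAddSubgroup ⊔ AddSubgroup.zmultiples g := by
    apply le_antisymm
    · intro z hz
      obtain ⟨m, hm⟩ := hgen z hz
      exact mem_sup_zmultiples_iff.2 ⟨m, by simpa using hm⟩
    · refine sup_le (fun z hz => Ideal.pow_le_pow_right (Nat.le_succ k) hz) ?_
      rw [AddSubgroup.zmultiples_le]
      exact hg
  have hg' : g ∉ (augIdeal X Y ^ (k + 1)).toAddSubgroup := by
    intro hg'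
    refine hk (eq_bot_of_augIdeal_pow_le hN fun z hz => ?_)
    obtain ⟨m, hm⟩ := hgen z hz
    simpa using Ideal.add_mem _ hm (Ideal.mul_mem_left _ (m : A) hg')
  rw [heq]
  refine relIndex_sup_zmultiples_eq_three hg' ?_
  simpa using h.three_mul_mem hg

theorem ExtensionRelations.relIndex_of_not_cycFactor (h : ExtensionRelations X Y a b) {k : ℕ}
    (hk : 1 ≤ k) (hc : ∀ i, 1 ≤ i → i ≤ k → ¬ CycFactor X Y i) :
    (augIdeal X Y ^ (k + 1)).toAddSubgroup.relIndex (augIdeal X Y ^ k).toAddSubgroup = 9 := by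
  obtain ⟨g, hg, g', hg', hgen⟩ := h.exists_two_generators hk hc
  set B := (augIdeal X Y ^ (k + 1)).toAddSubgroup with hB
  have hBmem : ∀ z, z ∈ B ↔ z ∈ augIdeal X Y ^ (k + 1) := fun z => Iff.rfl
  have hall : ∀ z ∈ augIdeal X Y ^ k,
      z ∈ B ⊔ AddSubgroup.zmultiples g ⊔ AddSubgroup.zmultiples g' := by
    refine augIdeal_pow_le_addSubgroup h.integral
      (fun z hz => AddSubgroup.mem_sup_left (AddSubgroup.mem_sup_left hz)) fun i j hij => ?_
    obtain ⟨m, l, hml⟩ := hgen i j hij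
    refine mem_sup_zmultiples_iff.2 ⟨l, mem_sup_zmultiples_iff.2 ⟨m, ?_⟩⟩
    rw [hBmem]
    convert hml using 1
    simp only [zsmul_eq_mul]
    ring
  have heq : (augIdeal X Y ^ k).toAddSubgroup =
      B ⊔ AddSubgroup.zmultiples g ⊔ AddSubgroup.zmultiples g' := by
    apply le_antisymm hall
    refine sup_le (sup_le (fun z hz => Ideal.pow_le_pow_right (Nat.le_succ k) hz) ?_) ?_
    · rw [AddSubgroup.zmultiples_le]; exact hg
    · rw [AddSubgroup.zmultiples_le]; exact hg'
  -- Noncyclicity says that no single element generates modulo `B`. Hence adjoining `g` and then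
  -- `g'` gives two proper steps, each of index `3`.
  have hcyc : ∀ z ∈ augIdeal X Y ^ k,
      (augIdeal X Y ^ k).toAddSubgroup ≤ B ⊔ AddSubgroup.zmultiples z → False := by
    intro z hz hle
    refine hc k hk le_rfl ⟨z, hz, fun w hw => ?_⟩
    obtain ⟨m, hm⟩ := mem_sup_zmultiples_iff.1 (hle hw)
    exact ⟨m, by simpa [hBmem] using hm⟩
  have hg1 : g ∉ B := by
    intro hgB
    refine hcyc g' hg' ?_
    rw [heq]
    refine sup_le (sup_le le_sup_left ?_) le_sup_right
    rw [AddSubgroup.zmultiples_le]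
    exact AddSubgroup.mem_sup_left hgB
  have hg2 : g' ∉ B ⊔ AddSubgroup.zmultiples g := by
    intro hgB
    refine hcyc g hg ?_
    rw [heq]
    refine sup_le le_rfl ?_
    rwa [AddSubgroup.zmultiples_le]
  have h1 := relIndex_sup_zmultiples_eq_three hg1 (by
    rw [hBmem]; simpa using h.three_mul_mem hg)
  have h2 := relIndex_sup_zmultiples_eq_three hg2 (AddSubgroup.mem_sup_left (by
    rw [hBmem]; simpa using h.three_mul_mem hg'))
  rw [heq, ← AddSubgroup.relIndex_mul_relIndex B (B ⊔ AddSubgroup.zmultiples g) _ le_sup_left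
    le_sup_left, h1, h2]

/-- The order of the ring in terms of the numbers of noncyclic and of nontrivial factors. -/
theorem ExtensionRelations.card_eq (h : ExtensionRelations X Y a b) {n d : ℕ}
    (hn : augIdeal X Y ^ n ≠ ⊥) (hn' : augIdeal X Y ^ (n + 1) = ⊥)
    (hc : ∀ i, 1 ≤ i → i ≤ d → ¬ CycFactor X Y i) (hc' : CycFactor X Y (d + 1))
    (hd : LinearFormKills X Y d) : Nat.card A = 3 ^ (n + d + 1) := by
  have hne : ∀ k, k ≤ n → augIdeal X Y ^ k ≠ ⊥ := fun k hk hk' =>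
    hn (le_bot_iff.1 (hk' ▸ Ideal.pow_le_pow_right hk))
  have hstep : ∀ k, (augIdeal X Y ^ (k + 1)).toAddSubgroup.index =
      (augIdeal X Y ^ (k + 1)).toAddSubgroup.relIndex (augIdeal X Y ^ k).toAddSubgroup *
        (augIdeal X Y ^ k).toAddSubgroup.index := fun k =>
    (AddSubgroup.relIndex_mul_index fun z hz => Ideal.pow_le_pow_right (Nat.le_succ k) hz).symm
  have hdn : d ≤ n := by
    rcases Nat.eq_zero_or_pos d with rfl | hd0
    · omega
    · by_contra hlt
      refine hc d hd0 le_rfl (cycFactor_of_eq_bot (le_bot_iff.1 ?_))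
      exact hn' ▸ Ideal.pow_le_pow_right (by omega)
  have h0 : (augIdeal X Y ^ 0).toAddSubgroup.index = 1 := by
    rw [AddSubgroup.index_eq_one]
    ext z
    simp
  -- The factor of degree `0` contributes `3`, those of degrees `1, …, d` contribute `9` each, and
  -- those of degrees `d + 1, …, n` contribute `3` each.
  have h1 : ∀ k, k ≤ d → (augIdeal X Y ^ (k + 1)).toAddSubgroup.index = 3 ^ (2 * k + 1) := by
    intro k
    induction k with
    | zero =>
      intro _
      rw [hstep, h0, h.relIndex_of_cycFactor hn' (hne 0 (by omega)) (cycFactor_zero h.integral)]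
      norm_num
    | succ k ih =>
      intro hk
      rw [hstep, ih (by omega), h.relIndex_of_not_cycFactor (by omega)
        fun i hi hik => hc i hi (by omega)]
      ring
  have h2 : ∀ k, d + k ≤ n →
      (augIdeal X Y ^ (d + k + 1)).toAddSubgroup.index = 3 ^ (2 * d + k + 1) := by
    intro k
    induction k with
    | zero => exact fun _ => h1 d le_rfl
    | succ k ih =>
      intro hk
      rw [hstep, ← add_assoc, ih (by omega), h.relIndex_of_cycFactor hn' (hne _ (by omega))
        (hc'.of_le h.integral hd (by omega) (by omega))]
      ring
  have h3 := h2 (n - d) (by omega)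
  rw [show d + (n - d) + 1 = n + 1 by omega, hn'] at h3
  have h4 : ((⊥ : Ideal A).toAddSubgroup) = ⊥ := rfl
  rw [h4, AddSubgroup.index_bot] at h3
  rw [h3]
  congr 1
  omega

end Factors

/-! ### Linear forms attached to elements of two-step centralizers. -/

section LinearForms

variable {A : Type*} [CommRing A] {X Y a b : A}

theorem left_pow_mul_right_pow_sub_mem_of_linearForm {k : ℕ} {v : ℤ}
    (h : ∀ w ∈ augIdeal X Y ^ k, X * w + v * (Y * w) ∈ augIdeal X Y ^ (k + 2)) (i : ℕ) :
    ∀ j, i + j = k + 1 → X ^ i * Y ^ j - ((-v) ^ i : ℤ) * Y ^ (k + 1) ∈ augIdeal X Y ^ (k + 2) := by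
  induction i with
  | zero =>
    intro j hj
    obtain rfl : j = k + 1 := by omega
    simp
  | succ i ih =>
    intro j hj
    have h1 := h (X ^ i * Y ^ j) (monomial_mem_augIdeal_pow (by omega))
    have h2 := Ideal.mul_mem_left _ (v : A) (ih (j + 1) (by omega))
    convert Ideal.sub_mem _ h1 h2 using 1
    push_cast
    ring

/-- Multiplication by `X` agrees with multiplication by `-vY` on the factor of degree `k`, so every
monomial of degree `k + 1` reduces to a multiple of `Y^(k+1)`. -/
theorem cycFactor_of_linearForm (hZ : IntegralModAug X Y) {k : ℕ} {v : ℤ}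
    (h : ∀ w ∈ augIdeal X Y ^ k, X * w + v * (Y * w) ∈ augIdeal X Y ^ (k + 2)) :
    CycFactor X Y (k + 1) :=
  cycFactor_of_monomial hZ (right_pow_mem_augIdeal_pow le_rfl) fun i j hij =>
    ⟨_, left_pow_mul_right_pow_sub_mem_of_linearForm h i j hij⟩

theorem cycFactor_of_right_mul_mem (hZ : IntegralModAug X Y) {k : ℕ}
    (h : ∀ w ∈ augIdeal X Y ^ k, Y * w ∈ augIdeal X Y ^ (k + 2)) : CycFactor X Y (k + 1) := by
  refine cycFactor_of_monomial hZ (left_pow_mem_augIdeal_pow le_rfl) fun i j hij => ?_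
  rcases j with _ | j
  · obtain rfl : i = k + 1 := by omega
    exact ⟨1, by simp⟩
  · refine ⟨0, ?_⟩
    convert h (X ^ i * Y ^ j) (monomial_mem_augIdeal_pow (by omega)) using 1
    push_cast
    ring

/-- The condition `Y^(d+1) = 0`, which is `t_{r+2} = 1`, singles out `Y` as the killing form: if `X
+ vY` kills the factors, all monomials of degree `d + 1` reduce to multiples of `Y^(d+1) = 0`, and
then `I^(d+1) = 0`. -/
theorem LinearFormKills.right_mul_eq_zero {d N : ℕ} (h : LinearFormKills X Y d)
    (hN : augIdeal X Y ^ N = ⊥) (hY : Y ^ (d + 1) = 0) : ∀ w ∈ augIdeal X Y ^ d, Y * w = 0 := by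
  rcases h with h | ⟨v, hv⟩
  · exact h
  · have hbot : augIdeal X Y ^ (d + 1) = ⊥ := by
      refine eq_bot_of_augIdeal_pow_le hN (augIdeal_pow_le_of_monomial fun i j hij => ?_)
      have := left_pow_mul_right_pow_sub_mem_of_linearForm (hv d le_rfl) i j hij
      simpa [hY] using this
    intro w hw
    simpa [hbot] using right_mul_mem_augIdeal_pow hw

/-- The linear part of `1` minus the action of `x y^v`, the typical element outside `⟨y, G'⟩` up to
powers and `G'`. -/
theorem one_sub_mul_pow_sub_mem (v : ℕ) :
    1 - (1 - X) * (1 - Y) ^ v - (X + v * Y) ∈ augIdeal X Y ^ 2 := by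
  induction v with
  | zero => simp
  | succ v ih =>
    have h1 : X * Y ∈ augIdeal X Y ^ 2 := left_mul_mem_augIdeal_pow (k := 1)
      (by simpa using right_mem_augIdeal)
    have h2 : Y * Y ∈ augIdeal X Y ^ 2 := right_mul_mem_augIdeal_pow (k := 1)
      (by simpa using right_mem_augIdeal)
    have h3 := Ideal.mul_mem_left _ (1 - Y) ih
    convert Ideal.sub_mem _ (Ideal.sub_mem _ h3 h1) (Ideal.mul_mem_left _ (v : A) h2) using 1
    push_cast
    ring

theorem linearForm_mem_of_mul_mem {l : A} {v : ℕ} (hl : l - (X + v * Y) ∈ augIdeal X Y ^ 2)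
    {k : ℕ} {w : A} (hw : w ∈ augIdeal X Y ^ k) (h : l * w ∈ augIdeal X Y ^ (k + 2)) :
    X * w + (v : ℤ) * (Y * w) ∈ augIdeal X Y ^ (k + 2) := by
  convert Ideal.sub_mem _ h (mul_mem_augIdeal_pow hl hw (k := k + 2) (by omega)) using 1
  push_cast
  ring

end LinearForms

/-! ### Rings of defect `0`: powers of `I` as sums of two power spans. -/

/-- The properties of the ring `A` attached to a group of defect `0`: `n + 2` is the class
and `d + 1` the coclass. -/
structure DefectZeroRing {A : Type*} [CommRing A] (X Y a b : A) (n d : ℕ) : Prop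
    extends ExtensionRelations X Y a b where
  pow_ne_bot : augIdeal X Y ^ n ≠ ⊥
  pow_eq_bot : augIdeal X Y ^ (n + 1) = ⊥
  one_le : 1 ≤ d
  not_cyc : ∀ i, 1 ≤ i → i ≤ d → ¬ CycFactor X Y i
  right_pow : Y ^ (d + 1) = 0
  right_kill : ∀ w ∈ augIdeal X Y ^ d, Y * w = 0
  disjoint : powSpan X 1 ⊓ powSpan Y 1 = ⊥

namespace DefectZeroRing

variable {A : Type*} [CommRing A] {X Y a b : A} {n d : ℕ}

theorem le (h : DefectZeroRing X Y a b n d) : d ≤ n := by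
  by_contra hlt
  refine h.not_cyc d h.one_le le_rfl (cycFactor_of_eq_bot (le_bot_iff.1 ?_))
  exact h.pow_eq_bot ▸ Ideal.pow_le_pow_right (by omega)

theorem eq_bot_of_lt (h : DefectZeroRing X Y a b n d) {k : ℕ} (hk : n < k) :
    augIdeal X Y ^ k = ⊥ :=
  le_bot_iff.1 (h.pow_eq_bot ▸ Ideal.pow_le_pow_right hk)

theorem ne_bot_of_le (h : DefectZeroRing X Y a b n d) {k : ℕ} (hk : k ≤ n) :
    augIdeal X Y ^ k ≠ ⊥ := fun hk' =>
  h.pow_ne_bot (le_bot_iff.1 (hk' ▸ Ideal.pow_le_pow_right hk))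

theorem left_pow (h : DefectZeroRing X Y a b n d) : X ^ (n + 1) = 0 := by
  have := left_pow_mem_augIdeal_pow (X := X) (Y := Y) (le_refl (n + 1))
  rwa [h.pow_eq_bot] at this

theorem monomial_eq_zero (h : DefectZeroRing X Y a b n d) {i j : ℕ} (hj : 1 ≤ j)
    (hij : d + 1 ≤ i + j) : X ^ i * Y ^ j = 0 := by
  obtain ⟨j, rfl⟩ := Nat.exists_eq_add_of_le' hj
  linear_combination h.right_kill (X ^ i * Y ^ j) (monomial_mem_augIdeal_pow (by omega))

theorem eq_zero_of_mem (h : DefectZeroRing X Y a b n d) {z : A} (hX : z ∈ powSpan X 1)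
    (hY : z ∈ powSpan Y 1) : z = 0 := by
  have : z ∈ powSpan X 1 ⊓ powSpan Y 1 := ⟨hX, hY⟩
  rwa [h.disjoint, AddSubgroup.mem_bot] at this

theorem powSpan_sup_le (k : ℕ) :
    powSpan X k ⊔ powSpan Y k ≤ (augIdeal X Y ^ k).toAddSubgroup :=
  sup_le (powSpan_le fun _ hi => left_pow_mem_augIdeal_pow hi)
    (powSpan_le fun _ hi => right_pow_mem_augIdeal_pow hi)

/-- If `X² ≡ Y²`, then `X^k ≡ Y^k` mod `I^(k+1)` for even `k`. Choosing `k` so that `I^(k+1)` is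
spanned by pure powers, independence separates the two sides and gives `Y^k ∈ I^(k+1)`. Then only
monomials with an odd exponent of `X` survive in degree `k`, and that factor is cyclic although `k ≤
d`. -/
theorem not_sq_sub_sq_mem (h : DefectZeroRing X Y a b n d) (hd : 2 ≤ d) :
    X ^ 2 - Y ^ 2 ∉ augIdeal X Y ^ 3 := by
  intro hXY
  have hYX : Y ^ 2 - X ^ 2 ∈ augIdeal Y X ^ 3 := by
    rw [← augIdeal_comm]
    simpa using Ideal.neg_mem_iff _ |>.2 hXY
  -- Monomials of degree `d + 1` containing `Y` vanish, and `X^(d+1) = X^(d-1)(X² - Y²)` has order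
  -- at least `d + 2`; so `I^(d+1) ≤ I^(d+2)`.
  have hbot : augIdeal X Y ^ (d + 1) = ⊥ := by
    refine eq_bot_of_augIdeal_pow_le h.pow_eq_bot (augIdeal_pow_le_of_monomial fun i j hij => ?_)
    rcases Nat.eq_zero_or_pos j with rfl | hj
    · have h0 := h.monomial_eq_zero (i := d - 1) (j := 2) (by omega) (by omega)
      have h1 := mul_mem_augIdeal_pow (X := X) (Y := Y) (k := d + 1 + 1)
        (left_pow_mem_augIdeal_pow (le_refl (d - 1))) hXY (by omega)
      have h2 : X ^ i * Y ^ 0 = X ^ (d - 1) * (X ^ 2 - Y ^ 2) := by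
        rw [mul_sub, h0, ← pow_add, pow_zero, mul_one, sub_zero]
        congr 1; omega
      rw [h2]; exact h1
    · rw [h.monomial_eq_zero hj hij.ge]; exact Ideal.zero_mem _
  -- an even degree `k` among `d - 1` and `d`
  obtain ⟨k, hk, hk2, hkd, hgen⟩ : ∃ k, Even k ∧ 2 ≤ k ∧ k ≤ d ∧
      ∀ z ∈ augIdeal X Y ^ (k + 1), z ∈ powSpan X (k + 1) ⊔ powSpan Y (k + 1) := by
    rcases Nat.even_or_odd d with hev | hodd
    · refine ⟨d, hev, hd, le_rfl, fun z hz => ?_⟩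
      rw [hbot, Ideal.mem_bot] at hz
      rw [hz]; exact AddSubgroup.zero_mem _
    · obtain ⟨t, rfl⟩ := hodd
      refine ⟨2 * t, by simp, by omega, by omega, ?_⟩
      refine augIdeal_pow_le_addSubgroup h.integral (fun z hz => ?_) fun i j hij => ?_
      · rw [hbot, Ideal.mem_bot] at hz
        rw [hz]; exact AddSubgroup.zero_mem _
      · rcases Nat.even_or_odd i with hi | hi
        · have := left_pow_mul_right_pow_sub_mem_of_even hXY (i := i) (j := j)
            (k := 2 * t + 1 + 1) hi (by omega)
          rw [hbot, Ideal.mem_bot, sub_eq_zero, hij] at this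
          rw [this]
          exact AddSubgroup.mem_sup_right (pow_mem_powSpan le_rfl)
        · have hj : Even j := by
            have : Odd (i + j) := hij ▸ (by simp)
            exact (Nat.odd_add.1 this).1 hi
          have := left_pow_mul_right_pow_sub_mem_of_even hYX (i := j) (j := i)
            (k := 2 * t + 1 + 1) hj (by omega)
          rw [← augIdeal_comm, hbot, Ideal.mem_bot, sub_eq_zero, add_comm j i, hij] at this
          rw [mul_comm (X ^ i), this]
          exact AddSubgroup.mem_sup_left (pow_mem_powSpan le_rfl)
  obtain ⟨σ, hσ, τ, hτ, hst⟩ := AddSubgroup.mem_sup.1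
    (hgen _ (left_pow_sub_right_pow_mem hXY hk le_rfl))
  -- `Y^k + τ = X^k - σ` lies in both power spans.
  have h0 : Y ^ k + τ = 0 := by
    refine h.eq_zero_of_mem ?_ ?_
    · have : Y ^ k + τ = X ^ k - σ := by linear_combination hst
      rw [this]
      exact AddSubgroup.sub_mem _ (pow_mem_powSpan (by omega)) (powSpan_anti (by omega) hσ)
    · exact AddSubgroup.add_mem _ (pow_mem_powSpan (by omega)) (powSpan_anti (by omega) hτ)
  have hYk : Y ^ k ∈ augIdeal X Y ^ (k + 1) := by
    have : Y ^ k = -τ := by linear_combination h0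
    rw [this]
    exact Ideal.neg_mem_iff _ |>.2 (powSpan_sup_le (k + 1) (AddSubgroup.mem_sup_right hτ))
  obtain ⟨k, rfl⟩ := Nat.exists_eq_add_of_le' (show 1 ≤ k by omega)
  refine h.not_cyc (k + 1) (by omega) hkd (cycFactor_of_monomial h.integral (g := X * Y ^ k) (by
    simpa using monomial_mem_augIdeal_pow (X := X) (Y := Y) (i := 1) (j := k) (by omega)) ?_)
  intro i j hij
  rcases Nat.even_or_odd' i with ⟨t, rfl | rfl⟩
  · refine ⟨0, ?_⟩
    have := left_pow_mul_right_pow_sub_mem_of_even hXY (i := 2 * t) (j := j) (k := k + 1 + 1)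
      (by simp) (by omega)
    rw [hij] at this
    simpa using Ideal.add_mem _ this hYk
  · refine ⟨1, ?_⟩
    have := left_mul_mem_augIdeal_pow (left_pow_mul_right_pow_sub_mem_of_even hXY (i := 2 * t)
      (j := j) (k := k + 1) (by simp) (by omega))
    rw [show 2 * t + j = k by omega] at this
    convert this using 1
    push_cast
    ring

theorem exists_quadratic (h : DefectZeroRing X Y a b n d) (hd : 2 ≤ d) :
    (∃ p : ℤ, X * Y - p * X ^ 2 ∈ augIdeal X Y ^ 3) ∨
      (∃ q : ℤ, X * Y - q * Y ^ 2 ∈ augIdeal X Y ^ 3) := by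
  rcases h.exists_quadratic_relation (h.not_cyc 1 le_rfl h.one_le) (h.not_cyc 2 (by omega) hd) with
    hp | hq | hXY
  · exact Or.inl hp
  · exact Or.inr hq
  · exact absurd hXY (h.not_sq_sub_sq_mem hd)

theorem exists_monomial_sub_mem (h : DefectZeroRing X Y a b n d) {i j k : ℕ} (hij : i + j = k) :
    ∃ m l : ℤ, X ^ i * Y ^ j - m * X ^ k - l * Y ^ k ∈ augIdeal X Y ^ (k + 1) := by
  subst hij
  rcases Nat.eq_zero_or_pos i with rfl | hi
  · exact ⟨0, 1, by simp⟩
  rcases Nat.eq_zero_or_pos j with rfl | hj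
  · exact ⟨1, 0, by simp⟩
  rcases h.one_le.eq_or_lt with hd | hd
  · exact ⟨0, 0, by simp [h.monomial_eq_zero (i := i) hj (by omega)]⟩
  · rcases h.exists_quadratic hd with ⟨p, hp⟩ | ⟨q, hq⟩
    · exact ⟨p ^ j, 0, by simpa using left_pow_mul_right_pow_sub_mem hp hi le_rfl⟩
    · exact ⟨0, q ^ i, by simpa using left_pow_mul_right_pow_sub_mem' hq hj le_rfl⟩

/-- Descending induction on `k` from `I^(n+1) = 0`: modulo `I^(k+1)` every monomial of degree `k` is
an integral combination of `X^k` and `Y^k`. -/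
theorem toAddSubgroup_pow (h : DefectZeroRing X Y a b n d) (k : ℕ) :
    (augIdeal X Y ^ k).toAddSubgroup = powSpan X k ⊔ powSpan Y k := by
  refine le_antisymm ?_ (powSpan_sup_le k)
  have key : ∀ t k, n + 1 ≤ k + t →
      (augIdeal X Y ^ k).toAddSubgroup ≤ powSpan X k ⊔ powSpan Y k := by
    intro t
    induction t with
    | zero =>
      intro k hk z hz
      have hz' : z ∈ augIdeal X Y ^ k := hz
      rw [h.eq_bot_of_lt (by omega), Ideal.mem_bot] at hz'
      rw [hz']; exact AddSubgroup.zero_mem _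
    | succ t ih =>
      intro k hk
      have hle : powSpan X (k + 1) ⊔ powSpan Y (k + 1) ≤ powSpan X k ⊔ powSpan Y k :=
        sup_le_sup (powSpan_anti (by omega)) (powSpan_anti (by omega))
      refine augIdeal_pow_le_addSubgroup h.integral (fun z hz => hle (ih _ (by omega) hz))
        fun i j hij => ?_
      obtain ⟨m, l, hml⟩ := h.exists_monomial_sub_mem hij
      have h1 := hle (ih (k + 1) (by omega) hml)
      have h2 : X ^ i * Y ^ j = (X ^ i * Y ^ j - m * X ^ k - l * Y ^ k) +
          (m • X ^ k + l • Y ^ k) := by simp only [zsmul_eq_mul]; ring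
      rw [h2]
      exact AddSubgroup.add_mem _ h1 (AddSubgroup.add_mem _
        (AddSubgroup.mem_sup_left (AddSubgroup.zsmul_mem _ (pow_mem_powSpan le_rfl) _))
        (AddSubgroup.mem_sup_right (AddSubgroup.zsmul_mem _ (pow_mem_powSpan le_rfl) _)))
  exact key (n + 1) k (by omega)

theorem mem_pow_iff (h : DefectZeroRing X Y a b n d) {k : ℕ} {z : A} :
    z ∈ augIdeal X Y ^ k ↔ z ∈ powSpan X k ⊔ powSpan Y k := by
  rw [← h.toAddSubgroup_pow]; rfl

theorem cycFactor_of_right_pow_mem (h : DefectZeroRing X Y a b n d) {k : ℕ}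
    (hY : Y ^ k ∈ augIdeal X Y ^ (k + 1)) : CycFactor X Y k := by
  refine cycFactor_of_monomial h.integral (left_pow_mem_augIdeal_pow le_rfl) fun i j hij => ?_
  obtain ⟨m, l, hml⟩ := h.exists_monomial_sub_mem hij
  exact ⟨m, by simpa using Ideal.add_mem _ hml (Ideal.mul_mem_left _ (l : A) hY)⟩

theorem cycFactor_of_left_pow_mem (h : DefectZeroRing X Y a b n d) {k : ℕ}
    (hX : X ^ k ∈ augIdeal X Y ^ (k + 1)) : CycFactor X Y k := by
  refine cycFactor_of_monomial h.integral (right_pow_mem_augIdeal_pow le_rfl) fun i j hij => ?_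
  obtain ⟨m, l, hml⟩ := h.exists_monomial_sub_mem hij
  refine ⟨l, ?_⟩
  convert Ideal.add_mem _ hml (Ideal.mul_mem_left _ (m : A) hX) using 1
  ring

theorem cycFactor_of_lt (h : DefectZeroRing X Y a b n d) {k : ℕ} (hk : d < k) :
    CycFactor X Y k :=
  h.cycFactor_of_right_pow_mem (by
    rw [show k = d + 1 + (k - (d + 1)) by omega, pow_add Y, h.right_pow, zero_mul]
    exact Ideal.zero_mem _)

theorem right_pow_ne_zero (h : DefectZeroRing X Y a b n d) : Y ^ d ≠ 0 := fun h0 =>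
  h.not_cyc d h.one_le le_rfl (h.cycFactor_of_right_pow_mem (by rw [h0]; exact Ideal.zero_mem _))

theorem left_pow_ne_zero (h : DefectZeroRing X Y a b n d) : X ^ n ≠ 0 := by
  intro h0
  rcases h.le.eq_or_lt with rfl | hlt
  · exact h.not_cyc d h.one_le le_rfl
      (h.cycFactor_of_left_pow_mem (by rw [h0]; exact Ideal.zero_mem _))
  · refine h.pow_ne_bot (le_bot_iff.1 fun z hz => ?_)
    rw [h.mem_pow_iff, powSpan_eq_bot h0, powSpan_eq_bot (X := Y) (k := n), sup_bot_eq] at hz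
    · exact hz
    · rw [show n = d + 1 + (n - (d + 1)) by omega, pow_add, h.right_pow, zero_mul]

theorem left_pow_ne_zero_of_le (h : DefectZeroRing X Y a b n d) {k : ℕ} (hk : k ≤ n) :
    X ^ k ≠ 0 := fun h0 => h.left_pow_ne_zero (by
  rw [show n = k + (n - k) by omega, pow_add, h0, zero_mul])

theorem right_pow_ne_zero_of_le (h : DefectZeroRing X Y a b n d) {k : ℕ} (hk : k ≤ d) :
    Y ^ k ≠ 0 := fun h0 => h.right_pow_ne_zero (by
  rw [show d = k + (d - k) by omega, pow_add, h0, zero_mul])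

end DefectZeroRing

/-! ### Annihilators of the powers of `I`. -/

namespace DefectZeroRing

variable {A : Type*} [CommRing A] {X Y a b : A} {n d : ℕ}

/-- The `X`-component `σ` of `X Y^k` is much deeper than the degree suggests. Multiplying by
`X^(d-k)` kills `X Y^k`, and by descending induction on `k` it also kills the `Y`-component, hence
it kills `σ`; only elements of depth at least `n + 1 - (d - k)` are killed. This is exactly the
depth needed for `X` to lower the index of `upperTerm`. -/
theorem left_mul_right_pow_mem (h : DefectZeroRing X Y a b n d) {k : ℕ} (hk : 1 ≤ k) :
    X * Y ^ k ∈ powSpan Y (k + 1) ⊔ powSpan X (n + 1 - d + k) := by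
  have hdn := h.le
  have zero : ∀ k, 1 ≤ k → d ≤ k → X * Y ^ k = 0 := fun k hk hdk => by
    simpa using h.monomial_eq_zero (i := 1) hk (by omega)
  have key : ∀ t k, 1 ≤ k → d ≤ k + t →
      X * Y ^ k ∈ powSpan Y (k + 1) ⊔ powSpan X (n + 1 - d + k) := by
    intro t
    induction t with
    | zero =>
      intro k hk hdk
      rw [zero k hk hdk]; exact AddSubgroup.zero_mem _
    | succ t ih =>
      intro k hk hdk
      by_cases hkd : d ≤ k
      · rw [zero k hk hkd]; exact AddSubgroup.zero_mem _
      have hmem : X * Y ^ k ∈ augIdeal X Y ^ (k + 1) :=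
        left_mul_mem_augIdeal_pow (right_pow_mem_augIdeal_pow le_rfl)
      obtain ⟨σ, hσ, τ, hτ, hst⟩ := AddSubgroup.mem_sup.1 (h.mem_pow_iff.1 hmem)
      have hstep : ∀ u w, k + 1 ≤ u → w ∈ powSpan Y u ⊔ powSpan X (n - d + u) →
          X * w ∈ powSpan Y (u + 1) ⊔ powSpan X (n - d + (u + 1)) := by
        intro u w hu hw
        obtain ⟨w1, h1, w2, h2, rfl⟩ := AddSubgroup.mem_sup.1 hw
        rw [mul_add]
        refine AddSubgroup.add_mem _ ?_ (AddSubgroup.mem_sup_right ?_)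
        · refine pow_mul_mem_of_mem_powSpan (fun i hi => ?_) h1
          exact sup_le_sup (powSpan_anti (by omega)) (powSpan_anti (by omega))
            (ih i (by omega) (by omega))
        · have := pow_mul_mem_powSpan (m := 1) h2
          rw [pow_one] at this
          exact this
      have hpow : ∀ s, X ^ s * τ ∈ powSpan Y (k + 1 + s) ⊔ powSpan X (n - d + (k + 1 + s)) := by
        intro s
        induction s with
        | zero => simpa using AddSubgroup.mem_sup_left hτ
        | succ s ihs =>
          rw [pow_succ', mul_assoc]
          exact hstep (k + 1 + s) _ (by omega) ihs
      -- Each multiplication by `X` shifts both bounds by one; after `d - k` of them they are `d +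
      -- 1` for `Y` and `n + 1` for `X`, where both spans vanish.
      have hτ0 : X ^ (d - k) * τ = 0 := by
        have := hpow (d - k)
        rwa [show k + 1 + (d - k) = d + 1 by omega, show n - d + (d + 1) = n + 1 by omega,
          powSpan_eq_bot h.right_pow, powSpan_eq_bot h.left_pow, sup_bot_eq,
          AddSubgroup.mem_bot] at this
      have h0 : X ^ (d - k) * (X * Y ^ k) = 0 := by
        rw [← mul_assoc, ← pow_succ]
        exact h.monomial_eq_zero hk (by omega)
      have hσ0 : X ^ (d - k) * σ = 0 := by linear_combination h0 - hτ0 + X ^ (d - k) * hst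
      have hσ' := mem_powSpan_of_pow_mul_eq_zero h.cube_left (by have := h.one_le; omega)
        h.left_pow_ne_zero h.left_pow (by omega) hσ hσ0
      rw [← hst, add_comm σ τ]
      exact AddSubgroup.add_mem _ (AddSubgroup.mem_sup_left hτ)
        (AddSubgroup.mem_sup_right (powSpan_anti (by omega) hσ'))
  exact key d k hk (by omega)

/-- The image in the ring of the `j`-th term of the upper central series. -/
def upperTerm (X Y : A) (n d j : ℕ) : AddSubgroup A :=
  powSpan X (n + 1 - j) ⊔ powSpan Y (max 1 (d + 1 - j))

theorem upperTerm_zero (h : DefectZeroRing X Y a b n d) : upperTerm X Y n d 0 = ⊥ := by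
  rw [upperTerm, show max 1 (d + 1 - 0) = d + 1 by omega, powSpan_eq_bot h.right_pow,
    powSpan_eq_bot (by simpa using h.left_pow), sup_bot_eq]

theorem left_mul_mem_upperTerm (h : DefectZeroRing X Y a b n d) {j : ℕ} {z : A}
    (hj : j + 1 ≤ n) (hz : z ∈ upperTerm X Y n d (j + 1)) : X * z ∈ upperTerm X Y n d j := by
  have hdn := h.le
  obtain ⟨z1, h1, z2, h2, rfl⟩ := AddSubgroup.mem_sup.1 hz
  rw [mul_add]
  refine AddSubgroup.add_mem _ (AddSubgroup.mem_sup_left ?_) ?_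
  · have := pow_mul_mem_powSpan (m := 1) h1
    rw [pow_one] at this
    exact powSpan_anti (by omega) this
  · refine pow_mul_mem_of_mem_powSpan (fun i hi => ?_) h2
    have := h.left_mul_right_pow_mem (k := i) (by omega)
    rw [sup_comm] at this
    exact sup_le_sup (powSpan_anti (by omega)) (powSpan_anti (by omega)) this

theorem right_mul_mem_upperTerm (h : DefectZeroRing X Y a b n d) {j : ℕ} {z : A}
    (hj : j + 1 ≤ n) (hz : z ∈ upperTerm X Y n d (j + 1)) : Y * z ∈ upperTerm X Y n d j := by
  have hdn := h.le
  obtain ⟨z1, h1, z2, h2, rfl⟩ := AddSubgroup.mem_sup.1 hz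
  rw [mul_add]
  refine AddSubgroup.add_mem _ ?_ (AddSubgroup.mem_sup_right ?_)
  · refine pow_mul_mem_of_mem_powSpan (fun i hi => ?_) h1
    have := h.mem_pow_iff.1 (right_mul_mem_augIdeal_pow (X := X) (Y := Y)
      (left_pow_mem_augIdeal_pow (le_refl i)))
    exact sup_le_sup (powSpan_anti (by omega)) (powSpan_anti (by omega)) this
  · have := pow_mul_mem_powSpan (m := 1) h2
    rw [pow_one] at this
    exact powSpan_anti (by omega) this

theorem mul_eq_zero_of_mem_upperTerm (h : DefectZeroRing X Y a b n d) {j : ℕ} (hj : j ≤ n) :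
    ∀ z ∈ upperTerm X Y n d j, ∀ w ∈ augIdeal X Y ^ j, w * z = 0 := by
  induction j with
  | zero =>
    intro z hz w _
    rw [h.upperTerm_zero, AddSubgroup.mem_bot] at hz
    rw [hz, mul_zero]
  | succ j ih =>
    intro z hz
    have : augIdeal X Y ^ (j + 1) ≤ LinearMap.ker (LinearMap.mulRight A z) := by
      refine augIdeal_pow_succ_le (fun w hw => ?_) (fun w hw => ?_)
      · have := ih (by omega) _ (h.left_mul_mem_upperTerm hj hz) w hw
        rw [LinearMap.mem_ker, LinearMap.mulRight_apply]
        linear_combination this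
      · have := ih (by omega) _ (h.right_mul_mem_upperTerm hj hz) w hw
        rw [LinearMap.mem_ker, LinearMap.mulRight_apply]
        linear_combination this
    exact fun w hw => this hw

theorem upperTerm_succ_of_lt (hn : d ≤ n) {i : ℕ} (hi : i < d) :
    upperTerm X Y n d (i + 1) = upperTerm X Y n d i ⊔ AddSubgroup.zmultiples (X ^ (n - i)) ⊔
      AddSubgroup.zmultiples (Y ^ (d - i)) := by
  rw [upperTerm, upperTerm, show n + 1 - (i + 1) = n - i by omega,
    show max 1 (d + 1 - (i + 1)) = d - i by omega, show max 1 (d + 1 - i) = d - i + 1 by omega,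
    show n + 1 - i = n - i + 1 by omega, powSpan_eq_sup (n - i), powSpan_eq_sup (d - i)]
  ac_rfl

/-- From index `d` on the `Y`-part is already all of `powSpan Y 1`, so only a power of `X` is added;
this is where the factors drop from order `9` to order `3`. -/
theorem upperTerm_succ_of_le {i : ℕ} (hi : d ≤ i) (hin : i < n) :
    upperTerm X Y n d (i + 1) = upperTerm X Y n d i ⊔ AddSubgroup.zmultiples (X ^ (n - i)) := by
  rw [upperTerm, upperTerm, show n + 1 - (i + 1) = n - i by omega,
    show max 1 (d + 1 - (i + 1)) = 1 by omega, show max 1 (d + 1 - i) = 1 by omega,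
    show n + 1 - i = n - i + 1 by omega, powSpan_eq_sup (n - i)]
  ac_rfl

theorem intCast_mul_left_mem_upperTerm (h : DefectZeroRing X Y a b n d) {i : ℕ} (hi : i < n)
    {m : ℤ} (hm : (3 : ℤ) ∣ m) : m * X ^ (n - i) ∈ upperTerm X Y n d i :=
  AddSubgroup.mem_sup_left (powSpan_anti (by omega)
    (intCast_mul_pow_mem_powSpan h.cube_left (by omega) hm))

theorem intCast_mul_right_mem_upperTerm (h : DefectZeroRing X Y a b n d) {i : ℕ} (hi : i < d)
    {m : ℤ} (hm : (3 : ℤ) ∣ m) : m * Y ^ (d - i) ∈ upperTerm X Y n d i :=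
  AddSubgroup.mem_sup_right (powSpan_anti (by omega)
    (intCast_mul_pow_mem_powSpan h.cube_right (by omega) hm))

theorem three_dvd_of_mul_left_pow_eq_zero (h : DefectZeroRing X Y a b n d) {m : ℤ}
    (hm : m * X ^ n = 0) : (3 : ℤ) ∣ m :=
  three_dvd_of_intCast_mul_eq_zero (three_mul_pow_eq_zero h.cube_left
    (h.one_le.trans h.le) h.left_pow) h.left_pow_ne_zero hm

theorem three_dvd_of_mul_right_pow_eq_zero (h : DefectZeroRing X Y a b n d) {m : ℤ}
    (hm : m * Y ^ d = 0) : (3 : ℤ) ∣ m :=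
  three_dvd_of_intCast_mul_eq_zero (three_mul_pow_eq_zero h.cube_right
    h.one_le h.right_pow) h.right_pow_ne_zero hm

theorem eq_zero_of_left_add_right (h : DefectZeroRing X Y a b n d) {i j : ℕ} (hi : 1 ≤ i)
    (hj : 1 ≤ j) {m l : ℤ} (hml : m * X ^ i + l * Y ^ j = 0) : m * X ^ i = 0 := by
  refine h.eq_zero_of_mem ?_ ?_
  · rw [← zsmul_eq_mul]
    exact AddSubgroup.zsmul_mem _ (pow_mem_powSpan hi) _
  · have : (m : A) * X ^ i = (-l) • Y ^ j := by
      rw [zsmul_eq_mul]; push_cast; linear_combination hml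
    rw [this]
    exact AddSubgroup.zsmul_mem _ (pow_mem_powSpan hj) _

/-- Modulo the `i`-th term, `z` is `m X^(n-i) + l Y^(d-i)`, without the second summand if `i ≥ d`.
Testing against `X^i` and `Y^i` gives equations involving `X^n` and `Y^d`, which force `3` to divide
the coefficients, and `3` moves these powers into the `i`-th term. -/
theorem mem_upperTerm_of_mul_eq_zero (h : DefectZeroRing X Y a b n d) {i : ℕ} (hi : i + 1 ≤ n)
    {z : A} (hz : z ∈ upperTerm X Y n d (i + 1)) (hann : ∀ w ∈ augIdeal X Y ^ i, w * z = 0) :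
    z ∈ upperTerm X Y n d i := by
  have hdn := h.le
  have hV := h.mul_eq_zero_of_mem_upperTerm (j := i) (by omega)
  have hXi : X ^ i ∈ augIdeal X Y ^ i := left_pow_mem_augIdeal_pow le_rfl
  have hYi : Y ^ i ∈ augIdeal X Y ^ i := right_pow_mem_augIdeal_pow le_rfl
  have hXX : X ^ i * X ^ (n - i) = X ^ n := by rw [← pow_add]; congr 1; omega
  rcases Nat.lt_or_ge i d with hid | hid
  · have hYY : Y ^ i * Y ^ (d - i) = Y ^ d := by rw [← pow_add]; congr 1; omega
    rw [upperTerm_succ_of_lt hdn hid] at hz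
    obtain ⟨l, hl⟩ := mem_sup_zmultiples_iff.1 hz
    obtain ⟨m, hv⟩ := mem_sup_zmultiples_iff.1 hl
    rw [zsmul_eq_mul, zsmul_eq_mul] at hv
    set v := z - l * Y ^ (d - i) - m * X ^ (n - i) with hvdef
    have e1 : m * X ^ n + l * (X ^ i * Y ^ (d - i)) = 0 := by
      linear_combination hann _ hXi - hV v hv _ hXi - m * hXX - X ^ i * hvdef
    have e2 : m * (X ^ (n - i) * Y ^ i) + l * Y ^ d = 0 := by
      linear_combination hann _ hYi - hV v hv _ hYi - l * hYY - Y ^ i * hvdef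
    have hml : (3 : ℤ) ∣ m ↔ (3 : ℤ) ∣ l := by
      constructor
      · intro hm
        apply h.three_dvd_of_mul_right_pow_eq_zero
        linear_combination e2 - hV _ (h.intCast_mul_left_mem_upperTerm (by omega) hm) _ hYi
      · intro hl
        apply h.three_dvd_of_mul_left_pow_eq_zero
        linear_combination e1 - hV _ (h.intCast_mul_right_mem_upperTerm hid hl) _ hXi
    -- One divisibility suffices. For `i = 0` it follows from independence, and for `d < n` from the
    -- vanishing of `X^(n-i) Y^i`. For `d = n` the quadratic relation, exact in top degree, turns
    -- one mixed monomial into a multiple of a pure power, and independence applies again.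
    have hor : (3 : ℤ) ∣ m ∨ (3 : ℤ) ∣ l := by
      rcases Nat.eq_zero_or_pos i with rfl | hi0
      · left
        apply h.three_dvd_of_mul_left_pow_eq_zero
        refine h.eq_zero_of_left_add_right (j := d) (l := l) (by omega) (by omega) ?_
        simpa using e1
      rcases hdn.lt_or_eq with hlt | rfl
      · right
        apply h.three_dvd_of_mul_right_pow_eq_zero
        rw [h.monomial_eq_zero hi0 (by omega)] at e2
        linear_combination e2
      · rcases h.exists_quadratic (by omega) with ⟨p, hp⟩ | ⟨q, hq⟩
        · right
          have := left_pow_mul_right_pow_sub_mem hp (i := d - i) (j := i) (k := d + 1) (by omega)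
            (by omega)
          rw [h.pow_eq_bot, Ideal.mem_bot, show d - i + i = d by omega] at this
          apply h.three_dvd_of_mul_right_pow_eq_zero
          have e3 : ((m * p ^ i : ℤ) : A) * X ^ d + l * Y ^ d = 0 := by
            push_cast; linear_combination e2 - m * this
          have e4 := h.eq_zero_of_left_add_right h.one_le h.one_le e3
          linear_combination e3 - e4
        · left
          have := left_pow_mul_right_pow_sub_mem' hq (i := i) (j := d - i) (k := d + 1) (by omega)
            (by omega)
          rw [h.pow_eq_bot, Ideal.mem_bot, show i + (d - i) = d by omega] at this
          apply h.three_dvd_of_mul_left_pow_eq_zero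
          refine h.eq_zero_of_left_add_right (j := d) (l := l * q ^ i) h.one_le h.one_le ?_
          push_cast; linear_combination e1 - l * this
    have hm : (3 : ℤ) ∣ m := hor.elim id hml.2
    have hz : z = v + m * X ^ (n - i) + l * Y ^ (d - i) := by rw [hvdef]; ring
    rw [hz]
    exact AddSubgroup.add_mem _ (AddSubgroup.add_mem _ hv
      (h.intCast_mul_left_mem_upperTerm (by omega) hm))
      (h.intCast_mul_right_mem_upperTerm hid (hml.1 hm))
  · rw [upperTerm_succ_of_le hid (by omega)] at hz
    obtain ⟨m, hv⟩ := mem_sup_zmultiples_iff.1 hz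
    rw [zsmul_eq_mul] at hv
    have e1 : m * X ^ n = 0 := by
      linear_combination hann _ hXi - hV _ hv _ hXi - m * hXX
    have hm := h.intCast_mul_left_mem_upperTerm (i := i) (by omega)
      (h.three_dvd_of_mul_left_pow_eq_zero e1)
    simpa using AddSubgroup.add_mem _ hv hm

/-- The terms `upperTerm` are the annihilators of the powers of the augmentation ideal. -/
theorem mem_upperTerm_iff (h : DefectZeroRing X Y a b n d) {j : ℕ} (hj : j ≤ n) {z : A} :
    z ∈ upperTerm X Y n d j ↔ ∀ w ∈ augIdeal X Y ^ j, w * z = 0 := by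
  refine ⟨h.mul_eq_zero_of_mem_upperTerm hj z, fun hann => ?_⟩
  have hdn := h.le
  -- Outside `I` the element is a unit and cannot annihilate `I^j ≠ 0`. So the descent may start at
  -- index `n`, whose term is all of `I`.
  have hmem : z ∈ augIdeal X Y := by
    by_contra hz
    have hu := isUnit_of_notMem_augIdeal h.pow_eq_bot h.integral h.three_mem hz
    refine h.ne_bot_of_le hj (le_bot_iff.1 fun w hw => ?_)
    exact (hu.mul_left_eq_zero).1 (hann w hw)
  have hn : z ∈ upperTerm X Y n d n := by
    rw [upperTerm, show n + 1 - n = 1 by omega, show max 1 (d + 1 - n) = 1 by omega]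
    exact h.mem_pow_iff.1 (by simpa using hmem)
  have key : ∀ t, j + t ≤ n → z ∈ upperTerm X Y n d (j + t) → z ∈ upperTerm X Y n d j := by
    intro t
    induction t with
    | zero => exact fun _ hz => hz
    | succ t ih =>
      intro ht hz
      exact ih (by omega) (h.mem_upperTerm_of_mul_eq_zero (i := j + t) ht hz fun w hw =>
        hann w (Ideal.pow_le_pow_right (by omega) hw))
  exact key (n - j) (by omega) (by rwa [show j + (n - j) = n by omega])

theorem isNilpotent_left (h : DefectZeroRing X Y a b n d) : IsNilpotent X := ⟨_, h.left_pow⟩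

theorem isNilpotent_right (h : DefectZeroRing X Y a b n d) : IsNilpotent Y := ⟨_, h.right_pow⟩

theorem left_pow_notMem (h : DefectZeroRing X Y a b n d) {k l : ℕ} (hk : 1 ≤ k) (hkn : k ≤ n)
    (hl : 1 ≤ l) : X ^ k ∉ powSpan X (k + 1) ⊔ powSpan Y l := by
  intro hmem
  obtain ⟨σ, hσ, τ, hτ, hst⟩ := AddSubgroup.mem_sup.1 hmem
  have hτ0 : τ = 0 := by
    refine h.eq_zero_of_mem ?_ (powSpan_anti hl hτ)
    rw [show τ = X ^ k - σ by linear_combination hst]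
    exact AddSubgroup.sub_mem _ (pow_mem_powSpan hk) (powSpan_anti (by omega) hσ)
  rw [hτ0, add_zero] at hst
  exact pow_notMem_powSpan_succ h.isNilpotent_left (h.left_pow_ne_zero_of_le hkn) (hst ▸ hσ)

theorem right_pow_notMem (h : DefectZeroRing X Y a b n d) {k l : ℕ} (hk : 1 ≤ k) (hkd : k ≤ d)
    (hl : 1 ≤ l) : Y ^ k ∉ powSpan X l ⊔ powSpan Y (k + 1) := by
  intro hmem
  obtain ⟨σ, hσ, τ, hτ, hst⟩ := AddSubgroup.mem_sup.1 hmem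
  have hσ0 : σ = 0 := by
    refine h.eq_zero_of_mem (powSpan_anti hl hσ) ?_
    rw [show σ = Y ^ k - τ by linear_combination hst]
    exact AddSubgroup.sub_mem _ (pow_mem_powSpan hk) (powSpan_anti (by omega) hτ)
  rw [hσ0, zero_add] at hst
  exact pow_notMem_powSpan_succ h.isNilpotent_right (h.right_pow_ne_zero_of_le hkd) (hst ▸ hτ)

theorem left_pow_notMem_upperTerm (h : DefectZeroRing X Y a b n d) {i : ℕ} (hi : i < n) :
    X ^ (n - i) ∉ upperTerm X Y n d i := by
  rw [upperTerm, show n + 1 - i = n - i + 1 by omega]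
  exact h.left_pow_notMem (by omega) (by omega) (by omega)

theorem three_nsmul_left_mem_upperTerm (h : DefectZeroRing X Y a b n d) {i : ℕ} (hi : i < n) :
    (3 : ℕ) • X ^ (n - i) ∈ upperTerm X Y n d i := by
  simpa using h.intCast_mul_left_mem_upperTerm hi (m := 3) (by simp)

theorem relIndex_upperTerm_of_le (h : DefectZeroRing X Y a b n d) {i : ℕ} (hi : d ≤ i)
    (hin : i < n) : (upperTerm X Y n d i).relIndex (upperTerm X Y n d (i + 1)) = 3 := by
  rw [upperTerm_succ_of_le hi hin]
  exact relIndex_sup_zmultiples_eq_three (h.left_pow_notMem_upperTerm hin)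
    (h.three_nsmul_left_mem_upperTerm hin)

theorem relIndex_upperTerm_of_lt (h : DefectZeroRing X Y a b n d) {i : ℕ} (hi : i < d) :
    (upperTerm X Y n d i).relIndex (upperTerm X Y n d (i + 1)) = 9 := by
  have hdn := h.le
  have h1 := relIndex_sup_zmultiples_eq_three (h.left_pow_notMem_upperTerm (i := i) (by omega))
    (h.three_nsmul_left_mem_upperTerm (by omega))
  have hg : Y ^ (d - i) ∉ upperTerm X Y n d i ⊔ AddSubgroup.zmultiples (X ^ (n - i)) := by
    rw [upperTerm, sup_right_comm, show n + 1 - i = n - i + 1 by omega, ← powSpan_eq_sup,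
      show max 1 (d + 1 - i) = d - i + 1 by omega]
    exact h.right_pow_notMem (by omega) (by omega) (by omega)
  have h2 := relIndex_sup_zmultiples_eq_three hg (AddSubgroup.mem_sup_left (by
    simpa using h.intCast_mul_right_mem_upperTerm hi (m := 3) (by simp)))
  rw [upperTerm_succ_of_lt hdn hi, ← AddSubgroup.relIndex_mul_relIndex (upperTerm X Y n d i)
    (upperTerm X Y n d i ⊔ AddSubgroup.zmultiples (X ^ (n - i))) _ le_sup_left le_sup_left, h1, h2]

theorem three_mul_mem_upperTerm (h : DefectZeroRing X Y a b n d) {i : ℕ} (hi : i + 1 ≤ n) {z : A}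
    (hz : z ∈ upperTerm X Y n d (i + 1)) : 3 * z ∈ upperTerm X Y n d i := by
  rw [h.mem_upperTerm_iff hi] at hz
  rw [h.mem_upperTerm_iff (by omega)]
  intro w hw
  linear_combination hz _ (h.three_mul_mem hw)

end DefectZeroRing

/-! ### The commutator subgroup as a commutative ring. -/

section Model

variable {G : Type*} [Group G]

/-- A description of the commutator subgroup of `G = ⟨x, y⟩`, as a module over the group ring of
`G/G'`, by a commutative ring `A`: the element `1` corresponds to the generator `[y, x]`. -/
structure CommutatorModel (x y : G) (A : Type*) [CommRing A] where
  hom : Multiplicative A →* G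
  act : G →* A
  injective : Function.Injective hom
  range_eq : hom.range = commutator G
  hom_one : hom (Multiplicative.ofAdd 1) = ⁅y, x⁆
  conj : ∀ g z, g * hom (Multiplicative.ofAdd z) * g⁻¹ = hom (Multiplicative.ofAdd (act g * z))
  integral : IntegralModAug (1 - act x) (1 - act y)
  one_sub_act_mem : ∀ g, 1 - act g ∈ augIdeal (1 - act x) (1 - act y)

theorem commutator_le_of_mem {x y : G} (hxy : Subgroup.closure {x, y} = (⊤ : Subgroup G))
    {N : Subgroup G} [N.Normal] (h : ⁅y, x⁆ ∈ N) : commutator G ≤ N := by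
  let π := QuotientGroup.mk' N
  have hc : π y * π x = π x * π y := by
    have : ⁅π y, π x⁆ = 1 := by
      rw [← map_commutatorElement]
      exact (QuotientGroup.eq_one_iff _).2 h
    exact commutatorElement_eq_one_iff_mul_comm.1 this
  have hcl : Subgroup.closure {π x, π y} = ⊤ := by
    have := congrArg (Subgroup.map π) hxy
    rwa [MonoidHom.map_closure, Set.image_pair, Subgroup.map_top_of_surjective _
      (QuotientGroup.mk'_surjective N)] at this
  have hcomm := Subgroup.isMulCommutative_closure (k := {π x, π y}) (by
    rintro u (rfl | rfl) v (rfl | rfl)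
    · rfl
    · exact hc.symm
    · exact hc
    · rfl)
  rw [commutator_def, Subgroup.commutator_le]
  intro g _ k _
  have hm : ∀ g, π g ∈ Subgroup.closure {π x, π y} := fun g => hcl ▸ Subgroup.mem_top _
  have h1 : π g * π k = π k * π g := by
    have := hcomm.is_comm.comm ⟨π g, hm g⟩ ⟨π k, hm k⟩
    exact congrArg Subtype.val this
  refine (QuotientGroup.eq_one_iff _).1 ?_
  change π ⁅g, k⁆ = 1
  rw [map_commutatorElement]
  exact commutatorElement_eq_one_iff_mul_comm.2 h1

theorem commute_of_mem_commutator (hmet : derivedSeries G 2 = ⊥) {u v : G}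
    (hu : u ∈ commutator G) (hv : v ∈ commutator G) : u * v = v * u := by
  have : ⁅u, v⁆ ∈ derivedSeries G 2 := by
    rw [derivedSeries_succ, derivedSeries_one]
    exact Subgroup.commutator_mem_commutator hu hv
  rw [hmet, Subgroup.mem_bot] at this
  exact commutatorElement_eq_one_iff_mul_comm.1 this

-- `A` is the subring of `End(G')` generated by the conjugations, and the isomorphism is evaluation
-- at `[y, x]`. It is onto because its image is a normal subgroup containing `[y, x]`, and injective
-- because in a commutative ring an operator killing a module generator kills the whole module.
open scoped IsMulCommutative in
theorem exists_commutatorModel.{u} {G : Type u} [Group G] (hmet : derivedSeries G 2 = ⊥) {x y : G}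
    (hxy : Subgroup.closure {x, y} = (⊤ : Subgroup G)) :
    ∃ (A : Type u) (_ : CommRing A), Nonempty (CommutatorModel x y A) := by
  let cg : CommGroup (commutator G) :=
    { (inferInstance : Group (commutator G)) with
      mul_comm := fun u v => Subtype.ext (commute_of_mem_commutator hmet u.2 v.2) }
  let M := Additive (commutator G)
  let ρ : G →* AddMonoid.End M :=
    { toFun := fun g => MonoidHom.toAdditive (MulAut.conjNormal g : MulAut (commutator G)).toMonoidHom
      map_one' := by
        ext m
        change ((MulAut.conjNormal (1 : G) : MulAut (commutator G)) m.toMul : G) = _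
        rw [MulAut.conjNormal_apply]
        simp
      map_mul' := by
        intro g k
        ext m
        change ((MulAut.conjNormal (g * k) : MulAut (commutator G)) m.toMul : G) =
          ((MulAut.conjNormal g : MulAut (commutator G))
            ((MulAut.conjNormal k : MulAut (commutator G)) m.toMul) : G)
        simp only [MulAut.conjNormal_apply]
        group }
  have hρ : ∀ g (m : M), ((ρ g m).toMul : G) = g * m.toMul * g⁻¹ := fun g m =>
    MulAut.conjNormal_apply g m.toMul
  have hcomm : ∀ u ∈ Set.range ρ, ∀ v ∈ Set.range ρ, u * v = v * u := by
    rintro _ ⟨g, rfl⟩ _ ⟨k, rfl⟩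
    rw [← map_mul, ← map_mul]
    ext m
    rw [hρ, hρ]
    -- `gk` and `kg` differ by an element of the abelian group `G'`, which acts trivially on `G'`.
    have h1 : (k * g)⁻¹ * (g * k) ∈ commutator G := by
      have : (k * g)⁻¹ * (g * k) = ⁅g⁻¹, k⁻¹⁆ := by
        rw [commutatorElement_def]; group
      rw [this]
      exact Subgroup.commutator_mem_commutator (Subgroup.mem_top _) (Subgroup.mem_top _)
    have h2 := commute_of_mem_commutator hmet h1 m.toMul.2
    calc g * k * (m.toMul : G) * (g * k)⁻¹
        = k * g * ((k * g)⁻¹ * (g * k) * (m.toMul : G)) * (g * k)⁻¹ := by group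
      _ = k * g * (m.toMul : G) * (k * g)⁻¹ := by rw [h2]; group
  have := Subring.isMulCommutative_closure hcomm
  let A := Subring.closure (Set.range ρ)
  let act : G →* A := ρ.codRestrict A fun g => Subring.subset_closure ⟨g, rfl⟩
  let s : M := Additive.ofMul ⟨⁅y, x⁆, Subgroup.commutator_mem_commutator (Subgroup.mem_top _)
    (Subgroup.mem_top _)⟩
  let hom : Multiplicative A →* G :=
    { toFun := fun z => (((z.toAdd : AddMonoid.End M) s).toMul : G)
      map_one' := rfl
      map_mul' := fun _ _ => rfl }
  have hconj : ∀ g z, g * hom (Multiplicative.ofAdd z) * g⁻¹ =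
      hom (Multiplicative.ofAdd (act g * z)) := fun g z => (hρ g _).symm
  have hone : hom (Multiplicative.ofAdd 1) = ⁅y, x⁆ := rfl
  have hrange : hom.range = commutator G := by
    apply le_antisymm
    · rintro _ ⟨z, rfl⟩
      exact (((z.toAdd : AddMonoid.End M) s).toMul).2
    · have : hom.range.Normal := ⟨by
        rintro _ ⟨z, rfl⟩ g
        exact ⟨_, (hconj g z.toAdd).symm⟩⟩
      exact commutator_le_of_mem hxy ⟨_, hone⟩
  have hinj : Function.Injective hom := by
    rw [injective_iff_map_eq_one]
    intro z hz
    have hz0 : (z.toAdd : AddMonoid.End M) s = 0 := by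
      apply Additive.toMul.injective
      exact Subtype.ext hz
    suffices hsuff : (z.toAdd : AddMonoid.End M) = 0 from
      Multiplicative.toAdd.injective (Subtype.ext hsuff)
    ext1 m
    obtain ⟨w, hw⟩ : (m.toMul : G) ∈ hom.range := by
      rw [hrange]; exact m.toMul.2
    have hw' : (w.toAdd : AddMonoid.End M) s = m := by
      apply Additive.toMul.injective
      exact Subtype.ext hw
    have hc : ((z.toAdd * w.toAdd : A) : AddMonoid.End M) s =
        ((w.toAdd * z.toAdd : A) : AddMonoid.End M) s := by rw [mul_comm]
    have hc' : (z.toAdd : AddMonoid.End M) ((w.toAdd : AddMonoid.End M) s) =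
        (w.toAdd : AddMonoid.End M) ((z.toAdd : AddMonoid.End M) s) := hc
    rw [hw', hz0, map_zero] at hc'
    exact hc'
  have hact : ∀ g, 1 - act g ∈ augIdeal (1 - act x) (1 - act y) := by
    intro g
    have hg : g ∈ Subgroup.closure {x, y} := hxy ▸ Subgroup.mem_top g
    induction hg using Subgroup.closure_induction with
    | mem g hg =>
      rcases hg with rfl | rfl
      · exact left_mem_augIdeal
      · exact right_mem_augIdeal
    | one => rw [map_one, sub_self]; exact Ideal.zero_mem _
    | mul g k _ _ hg hk =>
      have : 1 - act (g * k) = (1 - act g) + act g * (1 - act k) := by rw [map_mul]; ring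
      rw [this]
      exact Ideal.add_mem _ hg (Ideal.mul_mem_left _ _ hk)
    | inv g _ hg =>
      have h1 : act g⁻¹ * act g = 1 := by rw [← map_mul]; simp
      have : 1 - act g⁻¹ = -(act g⁻¹ * (1 - act g)) := by linear_combination -h1
      rw [this]
      exact (Ideal.neg_mem_iff _).2 (Ideal.mul_mem_left _ _ hg)
  have hint : IntegralModAug (1 - act x) (1 - act y) := by
    rintro ⟨z, hz⟩
    induction hz using Subring.closure_induction with
    | mem z hz =>
      obtain ⟨g, rfl⟩ := hz
      refine ⟨1, ?_⟩
      have := (Ideal.neg_mem_iff _).2 (hact g)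
      rw [neg_sub] at this
      rw [Int.cast_one]
      exact this
    | zero => exact ⟨0, by
        have : (⟨0, Subring.zero_mem _⟩ : A) = 0 := rfl
        rw [Int.cast_zero, sub_zero, this]; exact Ideal.zero_mem _⟩
    | one => exact ⟨1, by
        have : (⟨1, Subring.one_mem _⟩ : A) = 1 := rfl
        rw [Int.cast_one, this, sub_self]; exact Ideal.zero_mem _⟩
    | add u v hu hv ihu ihv =>
      obtain ⟨m, hm⟩ := ihu
      obtain ⟨l, hl⟩ := ihv
      refine ⟨m + l, ?_⟩
      convert Ideal.add_mem _ hm hl using 1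
      have : (⟨u + v, Subring.add_mem _ hu hv⟩ : A) = ⟨u, hu⟩ + ⟨v, hv⟩ := rfl
      rw [this]; push_cast; ring
    | neg u hu ihu =>
      obtain ⟨m, hm⟩ := ihu
      refine ⟨-m, ?_⟩
      convert (Ideal.neg_mem_iff _).2 hm using 1
      have : (⟨-u, Subring.neg_mem _ hu⟩ : A) = -⟨u, hu⟩ := rfl
      rw [this]; push_cast; ring
    | mul u v hu hv ihu ihv =>
      obtain ⟨m, hm⟩ := ihu
      obtain ⟨l, hl⟩ := ihv
      refine ⟨m * l, ?_⟩
      convert Ideal.add_mem _ (Ideal.mul_mem_right (⟨v, hv⟩ : A) _ hm)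
        (Ideal.mul_mem_left _ (m : A) hl) using 1
      have : (⟨u * v, Subring.mul_mem _ hu hv⟩ : A) = ⟨u, hu⟩ * ⟨v, hv⟩ := rfl
      rw [this]; push_cast; ring
  exact ⟨A, inferInstance, ⟨⟨hom, act, hinj, hrange, hone, hconj, hint, hact⟩⟩⟩

end Model

/-! ### Recognizing quotients of type `(3,3)` and of order `3`. -/

section ElementaryQuotients

/-- A group of order `3²` is abelian; exponent `3` makes it a two-dimensional space over `𝔽₃`. -/
theorem nonempty_mulEquiv_of_card_eq_nine {Q : Type*} [Group Q] (hcard : Nat.card Q = 9)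
    (h3 : ∀ q : Q, q ^ 3 = 1) : Nonempty (Q ≃* Multiplicative (ZMod 3 × ZMod 3)) := by
  have : Fact (Nat.Prime 3) := ⟨Nat.prime_three⟩
  have hfin : Finite Q := Nat.finite_of_card_ne_zero (by omega)
  have hcomm := IsPGroup.isMulCommutative_of_card_eq_prime_sq (p := 3) (G := Q) (by omega)
  let cg : CommGroup Q := { (inferInstance : Group Q) with mul_comm := hcomm.is_comm.comm }
  let md : Module (ZMod 3) (Additive Q) := AddCommGroup.zmodModule (n := 3) fun q => h3 q.toMul
  have hfinA : Finite (Additive Q) := hfin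
  have hrank : Module.finrank (ZMod 3) (Additive Q) = 2 := by
    have h1 := Module.natCard_eq_pow_finrank (K := ZMod 3) (V := Additive Q)
    have h2 : Nat.card (Additive Q) = 9 := hcard
    rw [h2, Nat.card_zmod] at h1
    exact (Nat.pow_right_injective (show 2 ≤ 3 by norm_num) (show 3 ^ 2 = 3 ^ _ from h1)).symm
  have e : Additive Q ≃ₗ[ZMod 3] ZMod 3 × ZMod 3 := LinearEquiv.ofFinrankEq _ _ (by
    rw [hrank, Module.finrank_prod, Module.finrank_self])
  exact ⟨AddEquiv.toMultiplicative e.toAddEquiv⟩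

theorem nonempty_mulEquiv_of_card_eq_three {Q : Type*} [Group Q] (hcard : Nat.card Q = 3) :
    Nonempty (Q ≃* Multiplicative (ZMod 3)) := by
  have : Fact (Nat.Prime 3) := ⟨Nat.prime_three⟩
  exact ⟨mulEquivOfPrimeCardEq (p := 3) hcard (by simp)⟩

theorem nonempty_quotient_mulEquiv_of_relIndex_eq_nine {G : Type*} [Group G] {H K : Subgroup G}
    [(K.subgroupOf H).Normal] (hi : K.relIndex H = 9) (h3 : ∀ g ∈ H, g ^ 3 ∈ K) :
    Nonempty ((H ⧸ K.subgroupOf H) ≃* Multiplicative (ZMod 3 × ZMod 3)) := by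
  refine nonempty_mulEquiv_of_card_eq_nine (by rw [← hi]; rfl) fun q => ?_
  obtain ⟨g, rfl⟩ := QuotientGroup.mk_surjective q
  rw [← QuotientGroup.mk_pow, QuotientGroup.eq_one_iff]
  exact h3 g g.2

theorem nonempty_quotient_mulEquiv_of_relIndex_eq_three {G : Type*} [Group G] {H K : Subgroup G}
    [(K.subgroupOf H).Normal] (hi : K.relIndex H = 3) :
    Nonempty ((H ⧸ K.subgroupOf H) ≃* Multiplicative (ZMod 3)) :=
  nonempty_mulEquiv_of_card_eq_three (by rw [← hi]; rfl)

end ElementaryQuotients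

/-! ### Elements and subgroups modulo `G'`. -/

section Abelianization

variable {G : Type*} [Group G]

theorem index_commutator_eq_nine
    (hab : Nonempty (Abelianization G ≃* Multiplicative (ZMod 3 × ZMod 3))) :
    (commutator G).index = 9 := by
  obtain ⟨e⟩ := hab
  have : Nat.card (Abelianization G) = 9 := by
    rw [Nat.card_congr e.toEquiv]
    simp [Nat.card_eq_fintype_card, ZMod.card]
  exact this

theorem abelianization_pow_three
    (hab : Nonempty (Abelianization G ≃* Multiplicative (ZMod 3 × ZMod 3)))
    (q : Abelianization G) : q ^ 3 = 1 := by
  obtain ⟨e⟩ := hab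
  apply e.injective
  rw [map_pow, map_one]
  generalize e q = z
  revert z
  decide

theorem abelianization_of_eq_one_iff {g : G} : Abelianization.of g = 1 ↔ g ∈ commutator G := by
  exact QuotientGroup.eq_one_iff g

theorem pow_three_mem_commutator
    (hab : Nonempty (Abelianization G ≃* Multiplicative (ZMod 3 × ZMod 3))) (g : G) :
    g ^ 3 ∈ commutator G := by
  rw [← abelianization_of_eq_one_iff, map_pow, abelianization_pow_three hab]

theorem mem_of_abelianization_eq {H : Subgroup G} (hH : commutator G ≤ H) {g k : G} (hg : g ∈ H)
    (h : Abelianization.of g = Abelianization.of k) : k ∈ H := by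
  have : g⁻¹ * k ∈ commutator G := by
    rw [← abelianization_of_eq_one_iff, map_mul, map_inv, h, inv_mul_cancel]
  have := H.mul_mem hg (hH this)
  rwa [mul_inv_cancel_left] at this

theorem exists_abelianization_eq {x y : G} (hxy : Subgroup.closure {x, y} = (⊤ : Subgroup G))
    (g : G) : ∃ i j : ℤ, Abelianization.of g = Abelianization.of x ^ i * Abelianization.of y ^ j := by
  have hg : Abelianization.of g ∈ (Subgroup.closure {x, y}).map Abelianization.of :=
    Subgroup.mem_map_of_mem _ (hxy ▸ Subgroup.mem_top g)
  rw [MonoidHom.map_closure, Set.image_pair, Subgroup.mem_closure_pair] at hg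
  obtain ⟨i, j, h⟩ := hg
  exact ⟨i, j, h.symm⟩

theorem zpow_eq_zpow_of_pow_three {Q : Type*} [Group Q] {q : Q} (h : q ^ 3 = 1) {i j : ℤ}
    (hij : i % 3 = j % 3) : q ^ i = q ^ j := by
  have h' : q ^ (3 : ℤ) = 1 := by exact_mod_cast h
  rw [← Int.emod_add_mul_ediv i 3, ← Int.emod_add_mul_ediv j 3, hij, zpow_add, zpow_add, zpow_mul,
    zpow_mul, h', one_zpow, one_zpow]

/-- A subgroup strictly between `G'` and `G` contains one of the elements `y`, `x y^v`. -/
theorem right_mem_or_exists_mem {x y : G} (hxy : Subgroup.closure {x, y} = (⊤ : Subgroup G))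
    (hab : Nonempty (Abelianization G ≃* Multiplicative (ZMod 3 × ZMod 3)))
    {H : Subgroup G} (hH : commutator G < H) : y ∈ H ∨ ∃ v : ℕ, x * y ^ v ∈ H := by
  obtain ⟨hle, hnle⟩ := hH
  obtain ⟨g, hg, hgC⟩ := Set.not_subset.1 hnle
  obtain ⟨i, j, hij⟩ := exists_abelianization_eq hxy g
  have hx3 := abelianization_pow_three hab (Abelianization.of x)
  have hy3 := abelianization_pow_three hab (Abelianization.of y)
  by_cases hi : i % 3 = 0
  · have hj : j % 3 ≠ 0 := by
      intro hj
      apply hgC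
      rw [SetLike.mem_coe, ← abelianization_of_eq_one_iff, hij,
        zpow_eq_zpow_of_pow_three hx3 (j := 0) (by simpa using hi),
        zpow_eq_zpow_of_pow_three hy3 (j := 0) (by simpa using hj)]
      simp
    left
    -- A nonzero residue mod `3` is its own inverse, so the `j`-th power of `g` has `y`-exponent
    -- `1`; the same device with `i` normalizes the exponent of `x` below.
    have hjj : (j * j) % 3 = 1 := by
      have h12 : j % 3 = 1 ∨ j % 3 = 2 := by omega
      rcases h12 with h | h <;> simp [Int.mul_emod, h]
    refine mem_of_abelianization_eq hle (H.zpow_mem hg j) ?_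
    rw [map_zpow, hij, zpow_eq_zpow_of_pow_three hx3 (j := 0) (by simpa using hi), zpow_zero,
      one_mul, ← zpow_mul, zpow_eq_zpow_of_pow_three hy3 (j := 1) (by simpa using hjj), zpow_one]
  · right
    have hii : (i * i) % 3 = 1 := by
      have h12 : i % 3 = 1 ∨ i % 3 = 2 := by omega
      rcases h12 with h | h <;> simp [Int.mul_emod, h]
    refine ⟨((j * i) % 3).toNat, mem_of_abelianization_eq hle (H.zpow_mem hg i) ?_⟩
    rw [map_zpow, hij, mul_zpow, ← zpow_mul, ← zpow_mul,
      zpow_eq_zpow_of_pow_three hx3 (j := 1) (by simpa using hii), zpow_one, map_mul, map_pow,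
      ← zpow_natCast, Int.toNat_of_nonneg (Int.emod_nonneg _ (by norm_num))]
    congr 1
    exact zpow_eq_zpow_of_pow_three hy3 (by simp)

end Abelianization

/-! ### Dictionary between `A` and subgroups of `G'`. -/

namespace CommutatorModel

variable {G : Type*} [Group G] {x y : G} {A : Type*} [CommRing A]

/-- The subgroup of `G'` corresponding to an additive subgroup of the ring. -/
def img (Φ : CommutatorModel x y A) (B : AddSubgroup A) : Subgroup G :=
  (AddSubgroup.toSubgroup B).map Φ.hom

variable (Φ : CommutatorModel x y A)

/-- The homomorphism of the model on elements of the ring. -/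
def val (z : A) : G := Φ.hom (Multiplicative.ofAdd z)

theorem val_add (u v : A) : Φ.val (u + v) = Φ.val u * Φ.val v := Φ.hom.map_mul _ _

theorem val_zero : Φ.val 0 = 1 := Φ.hom.map_one

theorem val_neg (u : A) : Φ.val (-u) = (Φ.val u)⁻¹ := Φ.hom.map_inv _

theorem val_pow (u : A) (m : ℕ) : Φ.val u ^ m = Φ.val (m * u) := by
  rw [← nsmul_eq_mul]
  exact (Φ.hom.map_pow _ _).symm

theorem val_zpow (u : A) (m : ℤ) : Φ.val u ^ m = Φ.val (m * u) := by
  rw [← zsmul_eq_mul]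
  exact (Φ.hom.map_zpow _ _).symm

theorem val_injective : Function.Injective Φ.val := fun _ _ h =>
  Multiplicative.ofAdd.injective (Φ.injective h)

theorem val_eq_one_iff {z : A} : Φ.val z = 1 ↔ z = 0 := by
  rw [← Φ.val_zero, Φ.val_injective.eq_iff]

theorem mem_commutator_iff {g : G} : g ∈ commutator G ↔ ∃ z, Φ.val z = g := by
  rw [← Φ.range_eq]; rfl

theorem val_one : Φ.val 1 = ⁅y, x⁆ := Φ.hom_one

theorem conj_val (g : G) (z : A) : g * Φ.val z * g⁻¹ = Φ.val (Φ.act g * z) := Φ.conj g z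

theorem commutatorElement_val_right (g : G) (z : A) :
    ⁅g, Φ.val z⁆ = Φ.val (-((1 - Φ.act g) * z)) := by
  rw [commutatorElement_def, conj_val, ← val_neg, ← val_add]
  congr 1; ring

theorem commutatorElement_val_left (g : G) (z : A) :
    ⁅Φ.val z, g⁆ = Φ.val ((1 - Φ.act g) * z) := by
  rw [← commutatorElement_inv, commutatorElement_val_right, ← val_neg, neg_neg]

theorem mem_img {B : AddSubgroup A} {g : G} : g ∈ Φ.img B ↔ ∃ z ∈ B, Φ.val z = g := Iff.rfl

theorem val_mem_img {B : AddSubgroup A} {z : A} : Φ.val z ∈ Φ.img B ↔ z ∈ B := by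
  rw [mem_img]
  exact ⟨fun ⟨w, hw, h⟩ => Φ.val_injective h ▸ hw, fun h => ⟨z, h, rfl⟩⟩

theorem img_top : Φ.img ⊤ = commutator G := by
  ext g
  rw [mem_img, Φ.mem_commutator_iff]
  simp

theorem img_bot : Φ.img ⊥ = ⊥ := by
  ext g
  simp [mem_img, val_zero, eq_comm]

theorem img_injective : Function.Injective Φ.img := fun B C h => by
  ext z
  rw [← Φ.val_mem_img, h, Φ.val_mem_img]

theorem img_sup (B C : AddSubgroup A) : Φ.img (B ⊔ C) = Φ.img B ⊔ Φ.img C := by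
  rw [img, img, img, ← Subgroup.map_sup, ← map_sup]

theorem img_inf (B C : AddSubgroup A) : Φ.img (B ⊓ C) = Φ.img B ⊓ Φ.img C := by
  ext g
  constructor
  · rintro ⟨z, hz, rfl⟩
    exact ⟨⟨z, hz.1, rfl⟩, ⟨z, hz.2, rfl⟩⟩
  · rintro ⟨⟨z, hz, rfl⟩, hz'⟩
    exact ⟨z, ⟨hz, Φ.val_mem_img.1 hz'⟩, rfl⟩

theorem relIndex_img (B C : AddSubgroup A) : (Φ.img B).relIndex (Φ.img C) = B.relIndex C := by
  rw [img, img, Subgroup.relIndex_map_map_of_injective _ _ Φ.injective]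
  rfl

theorem img_closure (S : Set A) : Φ.img (AddSubgroup.closure S) = Subgroup.closure (Φ.val '' S) := by
  apply le_antisymm
  · rintro _ ⟨z, hz, rfl⟩
    change Φ.val z.toAdd ∈ _
    have hz' : z.toAdd ∈ AddSubgroup.closure S := hz
    clear hz
    generalize z.toAdd = z' at hz'
    induction hz' using AddSubgroup.closure_induction with
    | mem z hz => exact Subgroup.subset_closure ⟨z, hz, rfl⟩
    | zero => rw [val_zero]; exact Subgroup.one_mem _
    | add u v _ _ hu hv => rw [val_add]; exact Subgroup.mul_mem _ hu hv
    | neg u _ hu => rw [val_neg]; exact Subgroup.inv_mem _ hu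
  · rw [Subgroup.closure_le]
    rintro _ ⟨z, hz, rfl⟩
    exact Φ.val_mem_img.2 (AddSubgroup.subset_closure hz)

theorem card_eq (Φ : CommutatorModel x y A) : Nat.card A = Nat.card (commutator G) := by
  have : Nat.card (Multiplicative A) = Nat.card Φ.hom.range :=
    Nat.card_congr (MonoidHom.ofInjective Φ.injective).toEquiv
  rw [Φ.range_eq] at this
  exact this

/-- The image of the powers of the augmentation ideal is the lower central series. -/
theorem gam_eq_img (k : ℕ) : gam G (k + 2) =
    Φ.img (augIdeal (1 - Φ.act x) (1 - Φ.act y) ^ k).toAddSubgroup := by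
  induction k with
  | zero =>
    have : (augIdeal (1 - Φ.act x) (1 - Φ.act y) ^ 0).toAddSubgroup = ⊤ := by ext z; simp
    rw [this, Φ.img_top]
    rfl
  | succ k ih =>
    have hstep : gam G (k + 1 + 2) = ⁅gam G (k + 2), ⊤⁆ := rfl
    rw [hstep, ih]
    apply le_antisymm
    · rw [Subgroup.commutator_le]
      rintro _ ⟨z, hz, rfl⟩ g _
      change ⁅Φ.val z.toAdd, g⁆ ∈ _
      rw [commutatorElement_val_left, val_mem_img]
      exact mul_mem_augIdeal_pow (i := 1) (by simpa using Φ.one_sub_act_mem g) hz (by omega)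
    · rintro _ ⟨z, hz, rfl⟩
      have hz' : z.toAdd ∈ augIdeal (1 - Φ.act x) (1 - Φ.act y) ^ (k + 1) := hz
      -- `I^(k+1) = X I^k + Y I^k`, so every element is a product of a commutator with `x` and one
      -- with `y`.
      have hle : augIdeal (1 - Φ.act x) (1 - Φ.act y) ^ (k + 1) ≤
          Submodule.map (LinearMap.mulLeft A (1 - Φ.act x))
            (augIdeal (1 - Φ.act x) (1 - Φ.act y) ^ k) ⊔
          Submodule.map (LinearMap.mulLeft A (1 - Φ.act y))
            (augIdeal (1 - Φ.act x) (1 - Φ.act y) ^ k) :=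
        augIdeal_pow_succ_le (fun w hw => Submodule.mem_sup_left ⟨w, hw, rfl⟩)
          (fun w hw => Submodule.mem_sup_right ⟨w, hw, rfl⟩)
      obtain ⟨_, ⟨u, hu, rfl⟩, _, ⟨v, hv, rfl⟩, huv⟩ := Submodule.mem_sup.1 (hle hz')
      change Φ.val z.toAdd ∈ _
      rw [← huv, val_add, LinearMap.mulLeft_apply, LinearMap.mulLeft_apply,
        ← commutatorElement_val_left, ← commutatorElement_val_left]
      exact Subgroup.mul_mem _
        (Subgroup.commutator_mem_commutator (Φ.val_mem_img.2 hu) (Subgroup.mem_top _))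
        (Subgroup.commutator_mem_commutator (Φ.val_mem_img.2 hv) (Subgroup.mem_top _))

theorem val_mem_gam {k : ℕ} {z : A} :
    Φ.val z ∈ gam G (k + 2) ↔ z ∈ augIdeal (1 - Φ.act x) (1 - Φ.act y) ^ k := by
  rw [Φ.gam_eq_img, val_mem_img]; rfl

theorem mem_gam {k : ℕ} {g : G} :
    g ∈ gam G (k + 2) ↔ ∃ z ∈ augIdeal (1 - Φ.act x) (1 - Φ.act y) ^ k, Φ.val z = g := by
  rw [Φ.gam_eq_img, mem_img]; rfl

theorem val_pow_act (g : G) (k : ℕ) :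
    Φ.val ((1 - Φ.act g) ^ k) = iterComm ⁅y, x⁆ g k := by
  induction k with
  | zero => rw [pow_zero, val_one]; rfl
  | succ k ih =>
    rw [pow_succ', ← commutatorElement_val_left, ih]; rfl

theorem sElt_eq (k : ℕ) : sElt x y (k + 2) = Φ.val ((1 - Φ.act x) ^ k) := (Φ.val_pow_act x k).symm

theorem tElt_eq (k : ℕ) : tElt x y (k + 2) = Φ.val ((1 - Φ.act y) ^ k) := (Φ.val_pow_act y k).symm

theorem sigmaSub_eq {n : ℕ} (hn : Group.nilpotencyClass G = n + 2)
    (h0 : (1 - Φ.act x) ^ (n + 1) = 0) (k : ℕ) :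
    SigmaSub x y (k + 2) = Φ.img (powSpan (1 - Φ.act x) k) := by
  apply le_antisymm
  · rw [SigmaSub, Subgroup.closure_le]
    rintro _ ⟨i, hi, -, rfl⟩
    obtain ⟨i, rfl⟩ := Nat.exists_eq_add_of_le' (show 2 ≤ i by omega)
    rw [Φ.sElt_eq]
    exact Φ.val_mem_img.2 (pow_mem_powSpan (by omega))
  · rw [powSpan, img_closure, Subgroup.closure_le]
    rintro _ ⟨_, ⟨i, hi, rfl⟩, rfl⟩
    by_cases hin : i ≤ n
    · exact Subgroup.subset_closure ⟨i + 2, by omega, by omega, (Φ.sElt_eq i).symm⟩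
    · rw [show i = n + 1 + (i - (n + 1)) by omega, pow_add, h0, zero_mul, val_zero]
      exact Subgroup.one_mem _

theorem tSub_eq {d : ℕ} (hd : coclass G 3 = d + 1) (h0 : (1 - Φ.act y) ^ (d + 1) = 0) (k : ℕ) :
    TSub 3 x y (k + 2) = Φ.img (powSpan (1 - Φ.act y) k) := by
  apply le_antisymm
  · rw [TSub, Subgroup.closure_le]
    rintro _ ⟨i, hi, -, rfl⟩
    obtain ⟨i, rfl⟩ := Nat.exists_eq_add_of_le' (show 2 ≤ i by omega)
    rw [Φ.tElt_eq]
    exact Φ.val_mem_img.2 (pow_mem_powSpan (by omega))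
  · rw [powSpan, img_closure, Subgroup.closure_le]
    rintro _ ⟨_, ⟨i, hi, rfl⟩, rfl⟩
    by_cases hin : i ≤ d + 1
    · exact Subgroup.subset_closure ⟨i + 2, by omega, by omega, (Φ.tElt_eq i).symm⟩
    · rw [show i = d + 1 + (i - (d + 1)) by omega, pow_add, h0, zero_mul, val_zero]
      exact Subgroup.one_mem _

/-- The relation between a commutator `[g, h] ∈ G'` and the cube of `h`. -/
theorem act_mul_cube {g h : G} {u w : A} (hu : ⁅g, h⁆ = Φ.val u) (hw : h ^ 3 = Φ.val w) :
    Φ.act g * w = (1 + Φ.act h + Φ.act h ^ 2) * u + w := by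
  apply Φ.val_injective
  -- Both sides are `g h³ g⁻¹ = (u h)³`; moving the factors `h` to the right conjugates the copies
  -- of `u` by `1`, `h`, `h²`.
  have e1 : (1 + Φ.act h + Φ.act h ^ 2) * u + w =
      u + (Φ.act h * u + (Φ.act h * (Φ.act h * u) + w)) := by ring
  rw [e1, ← conj_val, val_add, val_add, val_add, ← conj_val, ← conj_val, ← conj_val, ← hu, ← hw,
    commutatorElement_def]
  simp [pow_succ, mul_assoc]

/-- The first two relations hold because `x` and `y` commute with their own cubes, the norm
relations by conjugating `x³` with `y` and `y³` with `x`. -/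
theorem extensionRelations {a b : A} (ha : Φ.val a = x ^ 3) (hb : Φ.val b = y ^ 3) :
    ExtensionRelations (1 - Φ.act x) (1 - Φ.act y) a b where
  integral := Φ.integral
  left_mul := by
    rw [← Φ.val_eq_one_iff, ← commutatorElement_val_left, ha, commutatorElement_eq_one_iff_mul_comm]
    group
  right_mul := by
    rw [← Φ.val_eq_one_iff, ← commutatorElement_val_left, hb, commutatorElement_eq_one_iff_mul_comm]
    group
  left_norm := by
    have := Φ.act_mul_cube Φ.val_one.symm ha.symm
    linear_combination -this
  right_norm := by
    have h1 : ⁅x, y⁆ = Φ.val (-1) := by rw [val_neg, val_one, commutatorElement_inv]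
    have := Φ.act_mul_cube h1 hb.symm
    linear_combination this

end CommutatorModel

/-! ### Two-step centralizers, elementwise. -/

section TwoStepCentralizers

variable {G : Type*} [Group G]

theorem gam_two : gam G 2 = commutator G := rfl

theorem commutatorElement_mem_gam (hmet : derivedSeries G 2 = ⊥) {g w : G} {j : ℕ} (hj : 1 ≤ j)
    (hg : g ∈ gam G 2) (hw : w ∈ gam G j) : ⁅g, w⁆ ∈ gam G (j + 2) := by
  rcases hj.eq_or_lt with rfl | hj
  · exact Subgroup.commutator_mem_commutator hg (Subgroup.mem_top _)
  · have hw2 : w ∈ commutator G :=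
      (⊤ : Subgroup G).lowerCentralSeries_antitone (show 1 ≤ j - 1 by omega) hw
    rw [commutatorElement_eq_one_iff_mul_comm.2 (commute_of_mem_commutator hmet hg hw2)]
    exact Subgroup.one_mem _

/-- The elements satisfying the pointwise condition form a subgroup, since `γ_{j+2}` is normal, and
it contains `G'`, since `G` is metabelian. So the supremum is attained there. -/
theorem mem_twoStepCentralizer (hmet : derivedSeries G 2 = ⊥) {j : ℕ} (hj : 1 ≤ j) {g : G} :
    g ∈ twoStepCentralizer G j ↔ ∀ w ∈ gam G j, ⁅g, w⁆ ∈ gam G (j + 2) := by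
  have hnorm : (gam G (j + 2)).Normal := inferInstance
  let K : Subgroup G :=
    { carrier := {g | ∀ w ∈ gam G j, ⁅g, w⁆ ∈ gam G (j + 2)}
      one_mem' := fun w _ => by rw [commutatorElement_one_left]; exact Subgroup.one_mem _
      mul_mem' := fun {g k} hg hk w hw => by
        have : ⁅g * k, w⁆ = g * ⁅k, w⁆ * g⁻¹ * ⁅g, w⁆ := by
          simp only [commutatorElement_def]; group
        rw [this]
        exact Subgroup.mul_mem _ (hnorm.conj_mem _ (hk w hw) g) (hg w hw)
      inv_mem' := fun {g} hg w hw => by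
        have : ⁅g⁻¹, w⁆ = g⁻¹ * ⁅g, w⁆⁻¹ * g⁻¹⁻¹ := by
          simp only [commutatorElement_def]; group
        rw [this]
        exact hnorm.conj_mem _ (Subgroup.inv_mem _ (hg w hw)) _ }
  have hK : twoStepCentralizer G j = K := by
    apply le_antisymm
    · exact sSup_le fun H hH g hg w hw => hH.2 (Subgroup.commutator_mem_commutator hg hw)
    · exact le_sSup ⟨fun g hg w hw => commutatorElement_mem_gam hmet hj hg hw,
        Subgroup.commutator_le.2 fun g hg w hw => hg w hw⟩
  rw [hK]; rfl

theorem commutator_le_twoStepCentralizer (hmet : derivedSeries G 2 = ⊥) {j : ℕ} (hj : 1 ≤ j) :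
    commutator G ≤ twoStepCentralizer G j := fun _ hg =>
  (mem_twoStepCentralizer hmet hj).2 fun _ hw => commutatorElement_mem_gam hmet hj hg hw

theorem twoStepCentralizer_eq_top (hmet : derivedSeries G 2 = ⊥) {j : ℕ} (hj : 1 ≤ j)
    (h : gam G (j + 1) = ⊥) : twoStepCentralizer G j = ⊤ := by
  rw [eq_top_iff]
  intro g _
  rw [mem_twoStepCentralizer hmet hj]
  intro w hw
  have h1 : ⁅w, g⁆ ∈ gam G (j + 1) := by
    obtain ⟨j, rfl⟩ := Nat.exists_eq_add_of_le' hj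
    exact Subgroup.commutator_mem_commutator hw (Subgroup.mem_top _)
  rw [h, Subgroup.mem_bot] at h1
  rw [← commutatorElement_inv, h1, inv_one]
  exact Subgroup.one_mem _

end TwoStepCentralizers

/-! ### Two-step centralizers and cyclic factors in terms of `A`. -/

namespace CommutatorModel

variable {G : Type*} [Group G] {x y : G} {A : Type*} [CommRing A] (Φ : CommutatorModel x y A)

theorem mem_twoStepCentralizer_iff (hmet : derivedSeries G 2 = ⊥) {k : ℕ} {g : G} :
    g ∈ twoStepCentralizer G (k + 2) ↔
      ∀ w ∈ augIdeal (1 - Φ.act x) (1 - Φ.act y) ^ k,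
        (1 - Φ.act g) * w ∈ augIdeal (1 - Φ.act x) (1 - Φ.act y) ^ (k + 2) := by
  rw [mem_twoStepCentralizer hmet (by omega)]
  constructor
  · intro h w hw
    have := h _ (Φ.val_mem_gam.2 hw)
    rw [commutatorElement_val_right, Φ.val_mem_gam (k := k + 2)] at this
    simpa using (Ideal.neg_mem_iff _).2 this
  · intro h w hw
    obtain ⟨z, hz, rfl⟩ := Φ.mem_gam.1 hw
    rw [commutatorElement_val_right, Φ.val_mem_gam (k := k + 2)]
    exact (Ideal.neg_mem_iff _).2 (h z hz)

theorem one_sub_act_mul_pow_sub_mem (v : ℕ) :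
    1 - Φ.act (x * y ^ v) - ((1 - Φ.act x) + v * (1 - Φ.act y)) ∈
      augIdeal (1 - Φ.act x) (1 - Φ.act y) ^ 2 := by
  have := one_sub_mul_pow_sub_mem (X := 1 - Φ.act x) (Y := 1 - Φ.act y) v
  rwa [sub_sub_cancel, sub_sub_cancel, ← map_pow, ← map_mul] at this

/-- Outside the commutator subgroup, elements of the two-step centralizer of `γ_{k+2}` force the
factor `γ_{k+3}/γ_{k+4}` to be cyclic. -/
theorem cycFactor_of_lt_twoStepCentralizer (hmet : derivedSeries G 2 = ⊥)
    (hxy : Subgroup.closure {x, y} = (⊤ : Subgroup G))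
    (hab : Nonempty (Abelianization G ≃* Multiplicative (ZMod 3 × ZMod 3))) {k : ℕ}
    (h : commutator G < twoStepCentralizer G (k + 2)) :
    CycFactor (1 - Φ.act x) (1 - Φ.act y) (k + 1) := by
  rcases right_mem_or_exists_mem hxy hab h with hy | ⟨v, hv⟩
  · exact cycFactor_of_right_mul_mem Φ.integral ((Φ.mem_twoStepCentralizer_iff hmet).1 hy)
  · exact cycFactor_of_linearForm (v := v) Φ.integral fun w hw =>
      linearForm_mem_of_mul_mem (Φ.one_sub_act_mul_pow_sub_mem v) hw
        ((Φ.mem_twoStepCentralizer_iff hmet).1 hv w hw)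

theorem isCyclic_iff_cycFactor (k : ℕ) :
    IsCyclic (gam G (k + 2) ⧸ (gam G (k + 3)).subgroupOf (gam G (k + 2))) ↔
      CycFactor (1 - Φ.act x) (1 - Φ.act y) k := by
  constructor
  · rintro ⟨q, hq⟩
    obtain ⟨⟨_, hg⟩, rfl⟩ := QuotientGroup.mk_surjective q
    obtain ⟨g, hg', rfl⟩ := Φ.mem_gam.1 hg
    refine ⟨g, hg', fun z hz => ?_⟩
    obtain ⟨m, hm⟩ := Subgroup.mem_zpowers_iff.1
      (hq (QuotientGroup.mk ⟨Φ.val z, Φ.val_mem_gam.2 hz⟩))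
    rw [← QuotientGroup.mk_zpow, QuotientGroup.eq] at hm
    have hm' : (Φ.val g ^ m)⁻¹ * Φ.val z ∈ gam G (k + 1 + 2) := hm
    rw [val_zpow, ← val_neg, ← val_add, Φ.val_mem_gam] at hm'
    refine ⟨m, ?_⟩
    convert hm' using 1
    ring
  · rintro ⟨g, hg, hgen⟩
    refine ⟨QuotientGroup.mk ⟨Φ.val g, Φ.val_mem_gam.2 hg⟩, fun q => ?_⟩
    obtain ⟨⟨_, hz⟩, rfl⟩ := QuotientGroup.mk_surjective q
    obtain ⟨z, hz', rfl⟩ := Φ.mem_gam.1 hz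
    obtain ⟨m, hm⟩ := hgen z hz'
    refine Subgroup.mem_zpowers_iff.2 ⟨m, ?_⟩
    rw [← QuotientGroup.mk_zpow, QuotientGroup.eq]
    change (Φ.val g ^ m)⁻¹ * Φ.val z ∈ gam G (k + 1 + 2)
    rw [val_zpow, ← val_neg, ← val_add, Φ.val_mem_gam]
    convert hm using 1
    ring

theorem gam_eq_bot_iff (k : ℕ) :
    gam G (k + 2) = ⊥ ↔ augIdeal (1 - Φ.act x) (1 - Φ.act y) ^ k = ⊥ := by
  rw [Φ.gam_eq_img, ← Φ.img_bot, Φ.img_injective.eq_iff]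
  exact Submodule.toAddSubgroup_injective.eq_iff (b := ⊥)

end CommutatorModel

/-! ### Class, coclass and the order of `G'`. -/

section Orders

variable {G : Type*} [Group G] [Finite G]

/-- Class at most `1` gives `|G| = 9`, and then coclass at least `2` forces class `0`, that is a
trivial group. -/
theorem two_le_nilpotencyClass (hG : IsPGroup 3 G) (hindex : (commutator G).index = 9)
    (hr2 : 2 ≤ coclass G 3) : 2 ≤ Group.nilpotencyClass G := by
  have : Fact (Nat.Prime 3) := ⟨Nat.prime_three⟩
  have hnil : Group.IsNilpotent G := hG.isNilpotent
  by_contra hlt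
  have h1 : (⊤ : Subgroup G).lowerCentralSeries 1 = ⊥ :=
    Subgroup.lowerCentralSeries_eq_bot_iff_nilpotencyClass_le.2 (by omega)
  have hC : commutator G = ⊥ := h1
  rw [hC, Subgroup.index_bot] at hindex
  have h9 : Nat.log 3 9 = 2 := by
    rw [show 9 = 3 ^ 2 by norm_num, Nat.log_pow (by norm_num)]
  rw [coclass, hindex, h9] at hr2
  have h0 : (⊤ : Subgroup G).lowerCentralSeries 0 = ⊥ :=
    Subgroup.lowerCentralSeries_eq_bot_iff_nilpotencyClass_le.2 (by omega)
  have hcard : Nat.card (⊤ : Subgroup G) = Nat.card (⊥ : Subgroup G) :=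
    congrArg (fun H : Subgroup G => Nat.card H) h0
  rw [Subgroup.card_top, Subgroup.card_bot] at hcard
  omega

theorem card_commutator (hG : IsPGroup 3 G) (hindex : (commutator G).index = 9) {n d : ℕ}
    (hc : Group.nilpotencyClass G = n + 2) (hr : coclass G 3 = d + 1) :
    Nat.card (commutator G) = 3 ^ (n + d + 1) := by
  have : Fact (Nat.Prime 3) := ⟨Nat.prime_three⟩
  obtain ⟨N, hN⟩ := hG.exists_card_eq
  have h1 := (commutator G).card_mul_index
  rw [hindex, hN] at h1
  rw [coclass, hN, Nat.log_pow (by norm_num), hc] at hr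
  have h2 : (3 : ℕ) ^ N = 3 ^ (n + d + 1) * 9 := by
    rw [show N = n + d + 1 + 2 by omega, pow_add]
    norm_num
  omega

end Orders

/-! ### Transfer of the hypotheses and of the upper central series to `A`. -/

/-- A group of defect `0` with suitable generators gives a ring of defect `0`. -/
theorem CommutatorModel.defectZeroRing {G : Type*} [Group G] [Finite G] {x y : G} {A : Type*}
    [CommRing A] (Φ : CommutatorModel x y A) (hG : IsPGroup 3 G) (hmet : derivedSeries G 2 = ⊥)
    (hab : Nonempty (Abelianization G ≃* Multiplicative (ZMod 3 × ZMod 3))) {n d : ℕ}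
    (hc : Group.nilpotencyClass G = n + 2) (hr : coclass G 3 = d + 1) (hd : 1 ≤ d)
    (hdef : HasDefect G 0) (hxy : Subgroup.closure {x, y} = (⊤ : Subgroup G))
    (hindep : SigmaSub x y 3 ⊓ TSub 3 x y 3 = ⊥) (ht : tElt x y (d + 1 + 2) = 1) :
    ∃ a b, DefectZeroRing (1 - Φ.act x) (1 - Φ.act y) a b n d := by
  have : Fact (Nat.Prime 3) := ⟨Nat.prime_three⟩
  have hnil : Group.IsNilpotent G := hG.isNilpotent
  obtain ⟨a, ha⟩ := Φ.mem_commutator_iff.1 (pow_three_mem_commutator hab x)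
  obtain ⟨b, hb⟩ := Φ.mem_commutator_iff.1 (pow_three_mem_commutator hab y)
  have hrel := Φ.extensionRelations ha hb
  have hbot : augIdeal (1 - Φ.act x) (1 - Φ.act y) ^ (n + 1) = ⊥ := by
    rw [← Φ.gam_eq_bot_iff]
    exact Subgroup.lowerCentralSeries_eq_bot_iff_nilpotencyClass_le.2 (by omega)
  have hne : augIdeal (1 - Φ.act x) (1 - Φ.act y) ^ n ≠ ⊥ := by
    rw [Ne, ← Φ.gam_eq_bot_iff]
    intro h
    have : Group.nilpotencyClass G ≤ n + 1 :=
      Subgroup.lowerCentralSeries_eq_bot_iff_nilpotencyClass_le.1 h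
    omega
  have hgam : gam G (n + 3) = ⊥ := (Φ.gam_eq_bot_iff (n + 1)).2 hbot
  have hindex := index_commutator_eq_nine hab
  have hs : 2 ≤ invS G ∧ gam G 2 < twoStepCentralizer G (invS G) := by
    -- The infimum of an empty set would be `0`, so a witness is required: the class `n + 2`, whose
    -- two-step centralizer is `G`. For `e` the same index works because `γ_{n+3}` is trivial.
    refine Nat.sInf_mem (s := {j : ℕ | 2 ≤ j ∧ gam G 2 < twoStepCentralizer G j}) ⟨n + 2, by omega, ?_⟩
    rw [twoStepCentralizer_eq_top hmet (by omega) hgam, lt_top_iff_ne_top, gam_two]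
    intro h
    rw [h, Subgroup.index_top] at hindex
    omega
  have hcyc : ∀ j, IsCyclic (gam G (j + 2 + 1) ⧸ (gam G (j + 2 + 2)).subgroupOf (gam G (j + 2 + 1))) ↔
      CycFactor (1 - Φ.act x) (1 - Φ.act y) (j + 1) := fun j => Φ.isCyclic_iff_cycFactor (j + 1)
  have he : 2 ≤ invE G ∧ IsCyclic (gam G (invE G + 1) ⧸
      (gam G (invE G + 2)).subgroupOf (gam G (invE G + 1))) := by
    refine Nat.sInf_mem (s := {j : ℕ | 2 ≤ j ∧
      IsCyclic (gam G (j + 1) ⧸ (gam G (j + 2)).subgroupOf (gam G (j + 1)))}) ⟨n + 2, by omega, ?_⟩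
    exact (hcyc n).2 (cycFactor_of_eq_bot hbot)
  have hmin : ∀ j, 2 ≤ j → j < invE G → ¬ IsCyclic (gam G (j + 1) ⧸
      (gam G (j + 2)).subgroupOf (gam G (j + 1))) := fun j hj hlt hcon =>
    Nat.notMem_of_lt_sInf hlt ⟨hj, hcon⟩
  have hdef' : ∀ g ∈ twoStepCentralizer G (invS G), ∀ w ∈ gam G (invE G), ⁅g, w⁆ = 1 := by
    intro g hg w hw
    have h1 := Subgroup.commutator_mem_commutator hg hw
    rw [hdef.2, hc, show n + 2 + 1 - 0 = n + 3 by omega, hgam] at h1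
    exact h1
  obtain ⟨e, heq⟩ := Nat.exists_eq_add_of_le' he.1
  rw [heq] at he hmin hdef'
  have hdef'' : ∀ g ∈ twoStepCentralizer G (invS G),
      ∀ w ∈ augIdeal (1 - Φ.act x) (1 - Φ.act y) ^ e, (1 - Φ.act g) * w = 0 := by
    intro g hg w hw
    have := hdef' g hg _ (Φ.val_mem_gam.2 hw)
    rwa [commutatorElement_val_right, Φ.val_eq_one_iff, neg_eq_zero] at this
  have hnot : ∀ i, 1 ≤ i → i ≤ e → ¬ CycFactor (1 - Φ.act x) (1 - Φ.act y) i := by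
    intro i hi hie
    obtain ⟨i, rfl⟩ := Nat.exists_eq_add_of_le' hi
    rw [← hcyc]
    exact hmin (i + 2) (by omega) (by omega)
  have hkill : LinearFormKills (1 - Φ.act x) (1 - Φ.act y) e := by
    rcases right_mem_or_exists_mem hxy hab hs.2 with hy | ⟨v, hv⟩
    · exact Or.inl (hdef'' y hy)
    · refine Or.inr ⟨v, fun k hk w hw => ?_⟩
      refine linearForm_mem_of_mul_mem (Φ.one_sub_act_mul_pow_sub_mem v) hw ?_
      rw [hdef'' _ hv w (Ideal.pow_le_pow_right hk hw)]
      exact Ideal.zero_mem _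
  have hcard := hrel.card_eq hne hbot hnot ((hcyc e).1 he.2) hkill
  rw [Φ.card_eq, card_commutator hG hindex hc hr] at hcard
  -- After the shift by `2`, `e` is the number of noncyclic factors. Comparing the two expressions
  -- for `|G'|` identifies it with `r - 1`.
  obtain rfl : e = d := by
    have := Nat.pow_right_injective (show 2 ≤ 3 by norm_num) hcard
    omega
  have hY : (1 - Φ.act y) ^ (e + 1) = 0 := by
    rw [Φ.tElt_eq, Φ.val_eq_one_iff] at ht
    exact ht
  have hX : (1 - Φ.act x) ^ (n + 1) = 0 := by
    have := left_pow_mem_augIdeal_pow (X := 1 - Φ.act x) (Y := 1 - Φ.act y) (le_refl (n + 1))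
    rwa [hbot] at this
  refine ⟨a, b,
    { toExtensionRelations := hrel
      pow_ne_bot := hne
      pow_eq_bot := hbot
      one_le := hd
      not_cyc := hnot
      right_pow := hY
      right_kill := hkill.right_mul_eq_zero hbot hY
      disjoint := ?_ }⟩
  rw [Φ.sigmaSub_eq hc hX 1, Φ.tSub_eq hr hY 1, ← Φ.img_inf, ← Φ.img_bot] at hindep
  exact Φ.img_injective hindep

/-- The upper central series below the commutator subgroup consists of the annihilators of the
powers of the augmentation ideal. -/
theorem CommutatorModel.zet_eq_img {G : Type*} [Group G] {x y : G} {A : Type*} [CommRing A]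
    (Φ : CommutatorModel x y A) {a b : A} {n d : ℕ}
    (h : DefectZeroRing (1 - Φ.act x) (1 - Φ.act y) a b n d)
    (hZ : zet G (n + 1) = commutator G) {j : ℕ} (hj : j ≤ n) :
    zet G j = Φ.img (DefectZeroRing.upperTerm (1 - Φ.act x) (1 - Φ.act y) n d j) := by
  induction j with
  | zero => rw [h.upperTerm_zero, Φ.img_bot]; rfl
  | succ j ih =>
    have ih := ih (by omega)
    ext g
    rw [zet, Subgroup.mem_upperCentralSeries_succ_iff, ← zet, ih]
    constructor
    · intro hg
      -- Below `ζ_{n+1} = G'` every central term is visible in the ring; for such elements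
      -- centrality need only be tested against `x` and `y`.
      have hgC : g ∈ commutator G := by
        rw [← hZ]
        refine Subgroup.upperCentralSeries_mono G (show j + 1 ≤ n + 1 by omega) ?_
        rw [Subgroup.mem_upperCentralSeries_succ_iff]
        intro k
        rw [← zet, ih]
        exact hg k
      obtain ⟨z, rfl⟩ := Φ.mem_commutator_iff.1 hgC
      have hx := hg x
      have hy := hg y
      rw [commutatorElement_val_left, val_mem_img, h.mem_upperTerm_iff (by omega)] at hx hy
      rw [val_mem_img, h.mem_upperTerm_iff hj]
      have : augIdeal (1 - Φ.act x) (1 - Φ.act y) ^ (j + 1) ≤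
          LinearMap.ker (LinearMap.mulRight A z) := by
        refine augIdeal_pow_succ_le (fun w hw => ?_) (fun w hw => ?_)
        · rw [LinearMap.mem_ker, LinearMap.mulRight_apply]
          linear_combination hx w hw
        · rw [LinearMap.mem_ker, LinearMap.mulRight_apply]
          linear_combination hy w hw
      exact fun w hw => this hw
    · rintro ⟨z, hz, rfl⟩ k
      change ⁅Φ.val z.toAdd, k⁆ ∈ _
      have hz' : z.toAdd ∈ DefectZeroRing.upperTerm (1 - Φ.act x) (1 - Φ.act y) n d (j + 1) := hz
      rw [h.mem_upperTerm_iff hj] at hz'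
      rw [commutatorElement_val_left, val_mem_img, h.mem_upperTerm_iff (by omega)]
      intro w hw
      rw [← mul_assoc]
      refine hz' _ ?_
      exact mul_mem_augIdeal_pow hw (j := 1) (by simpa using Φ.one_sub_act_mem k) (by omega)

/-! ### The upper central series at the level of `G'`. -/

section

variable {G : Type*} [Group G]

theorem lowerCentralSeries_le_upperCentralSeries {c : ℕ}
    (hc : (⊤ : Subgroup G).lowerCentralSeries c = ⊥) (j : ℕ) :
    (⊤ : Subgroup G).lowerCentralSeries (c - j) ≤ Subgroup.upperCentralSeries G j :=
  Subgroup.ascending_central_series_le_upper _ (Subgroup.is_ascending_rev_series_of_is_descending _ hc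
    Subgroup.lowerCentralSeries_isDescendingCentralSeries) j

theorem lowerCentralSeries_le_of_commutator_le {n : ℕ}
    (h : commutator G ≤ Subgroup.upperCentralSeries G n) :
    (⊤ : Subgroup G).lowerCentralSeries (n + 1) = ⊥ := by
  have key : ∀ i, i ≤ n →
      (⊤ : Subgroup G).lowerCentralSeries (i + 1) ≤ Subgroup.upperCentralSeries G (n - i) := by
    intro i
    induction i with
    | zero => exact fun _ => h
    | succ i ih =>
      intro hi
      rw [Subgroup.lowerCentralSeries_succ, Subgroup.commutator_le]
      intro g hg k _
      have := ih (by omega) hg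
      rw [show n - i = n - (i + 1) + 1 by omega, Subgroup.mem_upperCentralSeries_succ_iff] at this
      exact this k
  have := key n le_rfl
  rwa [Nat.sub_self, Subgroup.upperCentralSeries_zero, le_bot_iff] at this

/-- If `G'` were maximal, `G/G'` would be cyclic, but it has order `9` and exponent `3`. -/
theorem not_isCoatom_commutator
    (hab : Nonempty (Abelianization G ≃* Multiplicative (ZMod 3 × ZMod 3))) :
    ¬ IsCoatom (commutator G) := by
  intro hco
  obtain ⟨u, -, hu⟩ := SetLike.exists_of_lt (lt_top_iff_ne_top.2 hco.1)
  have htop : commutator G ⊔ Subgroup.zpowers u = ⊤ := by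
    refine hco.2 _ (lt_of_le_of_ne le_sup_left fun h => hu ?_)
    rw [h]
    exact Subgroup.mem_sup_right (Subgroup.mem_zpowers u)
  have hgen : ∀ q : Abelianization G, q ∈ Subgroup.zpowers (Abelianization.of u) := by
    intro q
    obtain ⟨g, rfl⟩ := QuotientGroup.mk_surjective q
    have hle : commutator G ⊔ Subgroup.zpowers u ≤
        (Subgroup.zpowers (Abelianization.of u)).comap Abelianization.of := by
      refine sup_le (fun k hk => ?_) ?_
      · rw [Subgroup.mem_comap, abelianization_of_eq_one_iff.2 hk]
        exact Subgroup.one_mem _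
      · rw [Subgroup.zpowers_le]
        exact Subgroup.mem_zpowers _
    exact hle (htop ▸ Subgroup.mem_top g)
  have h1 := orderOf_eq_card_of_forall_mem_zpowers hgen
  have h2 : Nat.card (Abelianization G) = 9 := index_commutator_eq_nine hab
  have h3 := Nat.le_of_dvd (by norm_num)
    (orderOf_dvd_of_pow_eq_one (abelianization_pow_three hab (Abelianization.of u)))
  omega

theorem commutatorElement_mul_pow_left (x y : G) (v : ℕ) : ⁅x * y ^ v, y⁆ = ⁅x, y⁆ := by
  have : y ^ v * y * (y ^ v)⁻¹ = y := by rw [← pow_succ, pow_succ']; group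
  calc ⁅x * y ^ v, y⁆ = x * (y ^ v * y * (y ^ v)⁻¹) * x⁻¹ * y⁻¹ := by
        rw [commutatorElement_def]; group
    _ = ⁅x, y⁆ := by rw [this, commutatorElement_def]

/-- If `N` contains the commutators of all elements with a member outside `G'`, then it contains
the commutator of the generators. -/
theorem commutatorElement_mem_of_lt {x y : G} (hxy : Subgroup.closure {x, y} = (⊤ : Subgroup G))
    (hab : Nonempty (Abelianization G ≃* Multiplicative (ZMod 3 × ZMod 3))) {H N : Subgroup G}
    (hH : commutator G < H) (hN : ∀ g ∈ H, ∀ k, ⁅g, k⁆ ∈ N) : ⁅y, x⁆ ∈ N := by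
  rcases right_mem_or_exists_mem hxy hab hH with hy | ⟨v, hv⟩
  · exact hN y hy x
  · have := hN _ hv y
    rw [commutatorElement_mul_pow_left] at this
    rw [← commutatorElement_inv]
    exact N.inv_mem this

/-- A term `ζ_{c-1}` larger than `G'` would contain `y` or some `x y^v`. The commutator of either
with the other generator is `[y, x]` up to inversion, so `G' ≤ ζ_{c-2}` and the class would be at
most `c - 1`. -/
theorem zet_eq_commutator {x y : G} (hxy : Subgroup.closure {x, y} = (⊤ : Subgroup G))
    (hab : Nonempty (Abelianization G ≃* Multiplicative (ZMod 3 × ZMod 3))) {n : ℕ}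
    (h1 : (⊤ : Subgroup G).lowerCentralSeries (n + 2) = ⊥)
    (h2 : (⊤ : Subgroup G).lowerCentralSeries (n + 1) ≠ ⊥) : zet G (n + 1) = commutator G := by
  have hle : commutator G ≤ zet G (n + 1) := by
    have := lowerCentralSeries_le_upperCentralSeries h1 (n + 1)
    rwa [show n + 2 - (n + 1) = 1 by omega] at this
  by_contra hne
  have hmem := commutatorElement_mem_of_lt (N := zet G n) hxy hab
    (lt_of_le_of_ne hle (Ne.symm hne)) fun g hg => Subgroup.mem_upperCentralSeries_succ_iff.1 hg
  exact h2 (lowerCentralSeries_le_of_commutator_le (commutator_le_of_mem hxy hmem))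

end

/-! ### Central terms and two-step centralizers for defect `0`. -/

namespace CommutatorModel

variable {G : Type*} [Group G] {x y : G} {A : Type*} [CommRing A] (Φ : CommutatorModel x y A)
  {a b : A} {n d : ℕ}

theorem relIndex_gam (k : ℕ) : (gam G (k + 3)).relIndex (gam G (k + 2)) =
    (augIdeal (1 - Φ.act x) (1 - Φ.act y) ^ (k + 1)).toAddSubgroup.relIndex
      (augIdeal (1 - Φ.act x) (1 - Φ.act y) ^ k).toAddSubgroup := by
  rw [Φ.gam_eq_img k, Φ.gam_eq_img (k + 1), Φ.relIndex_img]

theorem gam_two_eq (Φ : CommutatorModel x y A) : gam G 2 = Subgroup.closure {⁅y, x⁆} ⊔ gam G 3 := by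
  apply le_antisymm
  · intro g hg
    obtain ⟨z, -, rfl⟩ := (Φ.mem_gam (k := 0)).1 hg
    obtain ⟨m, hm⟩ := Φ.integral z
    have h1 : Φ.val z = ⁅y, x⁆ ^ m * Φ.val (z - m) := by
      rw [← Φ.val_one, val_zpow, ← val_add]
      congr 1; ring
    rw [h1]
    refine Subgroup.mul_mem_sup (Subgroup.zpow_mem _ (Subgroup.subset_closure (Set.mem_singleton _)) m) ?_
    exact (Φ.val_mem_gam (k := 1)).2 (by simpa using hm)
  · refine sup_le ?_ ((⊤ : Subgroup G).lowerCentralSeries_antitone (by norm_num))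
    rw [Subgroup.closure_le, Set.singleton_subset_iff]
    exact Subgroup.commutator_mem_commutator (Subgroup.mem_top _) (Subgroup.mem_top _)


theorem twoStepCentralizer_eq_commutator (hmet : derivedSeries G 2 = ⊥)
    (hxy : Subgroup.closure {x, y} = (⊤ : Subgroup G))
    (hab : Nonempty (Abelianization G ≃* Multiplicative (ZMod 3 × ZMod 3)))
    (h : DefectZeroRing (1 - Φ.act x) (1 - Φ.act y) a b n d) {j : ℕ} (hj : 1 ≤ j)
    (hjd : j ≤ d + 1) : twoStepCentralizer G j = commutator G := by
  have hle := commutator_le_twoStepCentralizer hmet hj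
  by_contra hne
  have hlt := lt_of_le_of_ne hle (Ne.symm hne)
  -- The case `j = 1` lies outside the ring description: there `[y, x] ∈ γ₃` would mean `1 ∈ I`,
  -- impossible for a nilpotent proper ideal.
  rcases hj.eq_or_lt with rfl | hj2
  · have hmem := commutatorElement_mem_of_lt (N := gam G 3) hxy hab hlt fun g hg k =>
      (mem_twoStepCentralizer hmet le_rfl).1 hg k (Subgroup.mem_top _)
    rw [← Φ.val_one, Φ.val_mem_gam (k := 1), pow_one, ← Ideal.eq_top_iff_one] at hmem
    have h1 := h.pow_eq_bot
    rw [hmem, Ideal.top_pow] at h1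
    exact h.pow_ne_bot (le_bot_iff.1 (h1 ▸ le_top))
  · obtain ⟨k, rfl⟩ := Nat.exists_eq_add_of_le' (show 2 ≤ j from hj2)
    exact h.not_cyc (k + 1) (by omega) (by omega)
      (Φ.cycFactor_of_lt_twoStepCentralizer hmet hxy hab hlt)

/-- `Y` kills `I^k`, so `y` belongs to the centralizer. If `x` did as well, `I^(k+1) ≤ I^(k+2)`
would follow, contradicting `k + 1 ≤ n`. An element with `x`-exponent prime to `3` would bring `x`
in. -/
theorem twoStepCentralizer_eq_closure (hmet : derivedSeries G 2 = ⊥)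
    (hxy : Subgroup.closure {x, y} = (⊤ : Subgroup G))
    (hab : Nonempty (Abelianization G ≃* Multiplicative (ZMod 3 × ZMod 3)))
    (h : DefectZeroRing (1 - Φ.act x) (1 - Φ.act y) a b n d) {k : ℕ} (hd : d ≤ k) (hk : k < n) :
    twoStepCentralizer G (k + 2) = Subgroup.closure {y} ⊔ commutator G := by
  have hle := commutator_le_twoStepCentralizer hmet (show 1 ≤ k + 2 by omega)
  have hkill : ∀ w ∈ augIdeal (1 - Φ.act x) (1 - Φ.act y) ^ k, (1 - Φ.act y) * w = 0 :=
    fun w hw => h.right_kill w (Ideal.pow_le_pow_right hd hw)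
  have hy : y ∈ twoStepCentralizer G (k + 2) :=
    (Φ.mem_twoStepCentralizer_iff hmet).2 fun w hw => by
      rw [hkill w hw]; exact Ideal.zero_mem _
  have hx : x ∉ twoStepCentralizer G (k + 2) := by
    intro hx
    refine h.ne_bot_of_le (k := k + 1) (by omega) (eq_bot_of_augIdeal_pow_le h.pow_eq_bot ?_)
    refine augIdeal_pow_succ_le ((Φ.mem_twoStepCentralizer_iff hmet).1 hx) fun w hw => ?_
    rw [hkill w hw]; exact Ideal.zero_mem _
  apply le_antisymm
  · intro g hg
    obtain ⟨i, j, hij⟩ := exists_abelianization_eq hxy g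
    have hx3 := abelianization_pow_three hab (Abelianization.of x)
    have hxi : x ^ i ∈ twoStepCentralizer G (k + 2) := by
      refine mem_of_abelianization_eq hle (Subgroup.mul_mem _ hg (Subgroup.zpow_mem _ hy (-j))) ?_
      rw [map_mul, hij, map_zpow, map_zpow, mul_assoc, ← zpow_add, add_neg_cancel, zpow_zero,
        mul_one]
    by_cases hi : i % 3 = 0
    · refine mem_of_abelianization_eq le_sup_right (g := y ^ j)
        (Subgroup.mem_sup_left (Subgroup.zpow_mem _ (Subgroup.subset_closure (Set.mem_singleton _)) j)) ?_
      rw [hij, zpow_eq_zpow_of_pow_three hx3 (j := 0) (by simpa using hi), zpow_zero, one_mul,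
        map_zpow]
    · refine absurd (mem_of_abelianization_eq hle (Subgroup.zpow_mem _ hxi i) ?_) hx
      have hii : (i * i) % 3 = 1 := by
        have h12 : i % 3 = 1 ∨ i % 3 = 2 := by omega
        rcases h12 with h | h <;> simp [Int.mul_emod, h]
      rw [← zpow_mul, map_zpow, zpow_eq_zpow_of_pow_three hx3 (j := 1) (by simpa using hii),
        zpow_one]
  · refine sup_le ?_ hle
    rw [Subgroup.closure_le, Set.singleton_subset_iff]
    exact hy

theorem gam_eq_sup (h : DefectZeroRing (1 - Φ.act x) (1 - Φ.act y) a b n d) (k : ℕ) :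
    gam G (k + 2) = Φ.img (powSpan (1 - Φ.act x) k) ⊔ Φ.img (powSpan (1 - Φ.act y) k) := by
  rw [Φ.gam_eq_img, h.toAddSubgroup_pow, img_sup]

theorem pow_three_mem_gam (h : DefectZeroRing (1 - Φ.act x) (1 - Φ.act y) a b n d) (k : ℕ) :
    ∀ g ∈ gam G (k + 2), g ^ 3 ∈ gam G (k + 3) := by
  intro g hg
  obtain ⟨z, hz, rfl⟩ := Φ.mem_gam.1 hg
  rw [val_pow, Φ.val_mem_gam (k := k + 1)]
  exact h.three_mul_mem hz

theorem img_upperTerm_top (h : DefectZeroRing (1 - Φ.act x) (1 - Φ.act y) a b n d) :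
    Φ.img (DefectZeroRing.upperTerm (1 - Φ.act x) (1 - Φ.act y) n d n) = gam G 3 := by
  have := h.le
  rw [Φ.gam_eq_sup h 1, ← img_sup, DefectZeroRing.upperTerm, show n + 1 - n = 1 by omega,
    show max 1 (d + 1 - n) = 1 by omega]

end CommutatorModel

end CentralSeries

/-! ### Assembly of the statements about `G`. -/

open CentralSeries in
theorem corollary6p5 {G : Type*} [Group G] [Finite G]
    (hG : IsPGroup 3 G)
    (hmet : derivedSeries G 2 = ⊥)
    (hab : Nonempty (Abelianization G ≃* Multiplicative (ZMod 3 × ZMod 3)))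
    (c r : ℕ) (hc : Group.nilpotencyClass G = c) (hr : coclass G 3 = r) (hr2 : 2 ≤ r)
    (hdef : HasDefect G 0)
    (x y : G) (hxy : Subgroup.closure {x, y} = (⊤ : Subgroup G))
    (hindep : SigmaSub x y 3 ⊓ TSub 3 x y 3 = ⊥)
    (ht : tElt x y (r + 2) = 1) :
    -- the two-step centralizers
    ((∀ j, 1 ≤ j → j ≤ r → twoStepCentralizer G j = commutator G) ∧
      (∀ j, r + 1 ≤ j → j ≤ c - 1 →
        twoStepCentralizer G j = Subgroup.closure {y} ⊔ commutator G) ∧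
      (∀ j, c ≤ j → twoStepCentralizer G j = ⊤)) ∧
    (c = r + 1 → ∀ H : Subgroup G, IsCoatom H → ∀ j, 1 ≤ j → twoStepCentralizer G j ≠ H) ∧
    -- the factors of the lower central series
    ((∀ j, j = 1 ∨ (3 ≤ j ∧ j ≤ r + 1) →
        Nonempty ((gam G j ⧸ (gam G (j + 1)).subgroupOf (gam G j)) ≃*
          Multiplicative (ZMod 3 × ZMod 3))) ∧
      (∀ j, j = 2 ∨ (r + 2 ≤ j ∧ j ≤ c) →
        Nonempty ((gam G j ⧸ (gam G (j + 1)).subgroupOf (gam G j)) ≃*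
          Multiplicative (ZMod 3)))) ∧
    -- the terms of the lower central series
    (gam G 1 = Subgroup.closure {x, y} ⊔ commutator G ∧
      gam G 2 = Subgroup.closure {sElt x y 2} ⊔ gam G 3 ∧
      (∀ j, 3 ≤ j → j ≤ r + 1 → gam G j = PSub 3 x y j j) ∧
      (∀ j, r + 2 ≤ j → j ≤ c → gam G j = SigmaSub x y j)) ∧
    -- the factors of the upper central series
    ((∀ j, (1 ≤ j ∧ j ≤ r - 1) ∨ j = c →
        Nonempty ((zet G j ⧸ (zet G (j - 1)).subgroupOf (zet G j)) ≃*
          Multiplicative (ZMod 3 × ZMod 3))) ∧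
      (∀ j, r ≤ j → j ≤ c - 1 →
        Nonempty ((zet G j ⧸ (zet G (j - 1)).subgroupOf (zet G j)) ≃*
          Multiplicative (ZMod 3)))) ∧
    -- the terms of the upper central series
    ((∀ j, 1 ≤ j → j ≤ r - 1 → zet G j = PSub 3 x y (c + 1 - j) (r + 2 - j)) ∧
      (∀ j, r ≤ j → j ≤ c - 2 → zet G j = PSub 3 x y (c + 1 - j) 3) ∧
      zet G (c - 1) = Subgroup.closure {sElt x y 2} ⊔ zet G (c - 2) ∧
      zet G c = Subgroup.closure {x, y} ⊔ zet G (c - 1)) := by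
  have : Fact (Nat.Prime 3) := ⟨Nat.prime_three⟩
  have hnil : Group.IsNilpotent G := hG.isNilpotent
  have hindex := index_commutator_eq_nine hab
  have hc2 := two_le_nilpotencyClass hG hindex (by omega)
  obtain ⟨n, rfl⟩ := Nat.exists_eq_add_of_le' (show 2 ≤ c by omega)
  obtain ⟨d, rfl⟩ := Nat.exists_eq_add_of_le' (show 1 ≤ r by omega)
  obtain ⟨A, _, ⟨Φ⟩⟩ := exists_commutatorModel hmet hxy
  obtain ⟨a, b, h⟩ := Φ.defectZeroRing hG hmet hab hc hr (by omega) hdef hxy hindep ht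
  have hdn := h.le
  have hS := Φ.sigmaSub_eq hc h.left_pow
  have hT := Φ.tSub_eq hr h.right_pow
  have hbot : ∀ j, n + 2 ≤ j → (⊤ : Subgroup G).lowerCentralSeries j = ⊥ := fun j hj =>
    Subgroup.lowerCentralSeries_eq_bot_iff_nilpotencyClass_le.2 (by omega)
  have hZ : zet G (n + 1) = commutator G := by
    refine zet_eq_commutator hxy hab (hbot _ le_rfl) fun h0 => ?_
    have := Subgroup.lowerCentralSeries_eq_bot_iff_nilpotencyClass_le.1 h0
    omega
  have hZtop : zet G (n + 2) = ⊤ := by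
    rw [zet, ← hc]; exact Subgroup.upperCentralSeries_nilpotencyClass
  have hzet : ∀ j, j ≤ n → zet G j =
      Φ.img (DefectZeroRing.upperTerm (1 - Φ.act x) (1 - Φ.act y) n d j) := fun j hj =>
    Φ.zet_eq_img h hZ hj
  have hchi1 : ∀ j, 1 ≤ j → j ≤ d + 1 → twoStepCentralizer G j = commutator G := fun j hj hjd =>
    Φ.twoStepCentralizer_eq_commutator hmet hxy hab h hj hjd
  have hchi3 : ∀ j, n + 2 ≤ j → twoStepCentralizer G j = ⊤ := fun j hj =>
    twoStepCentralizer_eq_top hmet (by omega) (hbot _ (by omega))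
  have htop9 : (commutator G).relIndex ⊤ = 9 := by rw [Subgroup.relIndex_top_right, hindex]
  refine ⟨⟨hchi1, ?_, hchi3⟩, ?_, ⟨?_, ?_⟩, ⟨?_, ?_, ?_, ?_⟩, ⟨?_, ?_⟩, ?_, ?_, ?_, ?_⟩
  · intro j hj hjc
    obtain ⟨k, rfl⟩ := Nat.exists_eq_add_of_le' (show 2 ≤ j by omega)
    exact Φ.twoStepCentralizer_eq_closure hmet hxy hab h (by omega) (by omega)
  · intro hcr H hH j hj hjH
    -- Now `n = d`, so the range of centralizers `⟨y, G'⟩` is empty and only `G'` and `G` occur.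
    rcases Nat.lt_or_ge (d + 1) j with hjd | hjd
    · exact hH.1 (hjH ▸ hchi3 j (by omega))
    · exact not_isCoatom_commutator hab (hchi1 j hj hjd ▸ hjH ▸ hH)
  · rintro j (rfl | ⟨hj, hjd⟩)
    · exact nonempty_quotient_mulEquiv_of_relIndex_eq_nine htop9 fun g _ =>
        pow_three_mem_commutator hab g
    · obtain ⟨k, rfl⟩ := Nat.exists_eq_add_of_le' (show 2 ≤ j by omega)
      refine nonempty_quotient_mulEquiv_of_relIndex_eq_nine ?_ (Φ.pow_three_mem_gam h k)
      rw [Φ.relIndex_gam]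
      exact h.relIndex_of_not_cycFactor (by omega) fun i hi hik => h.not_cyc i hi (by omega)
  · intro j hj
    obtain ⟨k, rfl⟩ := Nat.exists_eq_add_of_le' (show 2 ≤ j by omega)
    refine nonempty_quotient_mulEquiv_of_relIndex_eq_three ?_
    rw [Φ.relIndex_gam]
    refine h.relIndex_of_cycFactor h.pow_eq_bot (h.ne_bot_of_le (by omega)) ?_
    rcases Nat.eq_zero_or_pos k with rfl | hk
    · exact cycFactor_zero h.integral
    · exact h.cycFactor_of_lt (by omega)
  · rw [hxy, top_sup_eq]; rfl
  · exact Φ.gam_two_eq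
  · intro j hj hjd
    obtain ⟨k, rfl⟩ := Nat.exists_eq_add_of_le' (show 2 ≤ j by omega)
    rw [PSub, hS, hT, Φ.gam_eq_sup h]
  · intro j hj hjc
    obtain ⟨k, rfl⟩ := Nat.exists_eq_add_of_le' (show 2 ≤ j by omega)
    have h0 : (1 - Φ.act y) ^ k = 0 := by
      rw [show k = d + 1 + (k - (d + 1)) by omega, pow_add, h.right_pow, zero_mul]
    rw [hS, Φ.gam_eq_sup h, powSpan_eq_bot h0, Φ.img_bot, sup_bot_eq]
  · rintro j (⟨hj, hjd⟩ | rfl)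
    · obtain ⟨i, rfl⟩ := Nat.exists_eq_add_of_le' hj
      refine nonempty_quotient_mulEquiv_of_relIndex_eq_nine ?_ ?_
      · rw [Nat.add_sub_cancel, hzet i (by omega), hzet (i + 1) (by omega), Φ.relIndex_img]
        exact h.relIndex_upperTerm_of_lt (by omega)
      · rw [Nat.add_sub_cancel, hzet i (by omega), hzet (i + 1) (by omega)]
        intro g hg
        obtain ⟨z, hz, rfl⟩ := Φ.mem_img.1 hg
        rw [Φ.val_pow, Φ.val_mem_img]
        exact h.three_mul_mem_upperTerm (by omega) hz
    · refine nonempty_quotient_mulEquiv_of_relIndex_eq_nine ?_ ?_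
      · rw [hZtop, show n + 2 - 1 = n + 1 by omega, hZ, htop9]
      · rw [hZtop, show n + 2 - 1 = n + 1 by omega, hZ]
        exact fun g _ => pow_three_mem_commutator hab g
  · intro j hj hjc
    obtain ⟨i, rfl⟩ := Nat.exists_eq_add_of_le' (show 1 ≤ j by omega)
    refine nonempty_quotient_mulEquiv_of_relIndex_eq_three ?_
    rw [Nat.add_sub_cancel, hzet i (by omega)]
    rcases Nat.lt_or_ge i n with hin | hin
    · rw [hzet (i + 1) (by omega), Φ.relIndex_img]
      exact h.relIndex_upperTerm_of_le (by omega) hin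
    -- The top cyclic factor `ζ_{c-1}/ζ_{c-2}` is `γ₂/γ₃`, since the annihilator of `I^n` is `I`.
    · obtain rfl : i = n := by omega
      rw [hZ, Φ.img_upperTerm_top h, ← gam_two, Φ.relIndex_gam 0]
      exact h.relIndex_of_cycFactor h.pow_eq_bot (h.ne_bot_of_le (by omega))
        (cycFactor_zero h.integral)
  · intro j hj hjd
    rw [hzet j (by omega), DefectZeroRing.upperTerm, Φ.img_sup, PSub,
      show n + 2 + 1 - j = n + 1 - j + 2 by omega, show d + 1 + 2 - j = d + 1 - j + 2 by omega,
      hS, hT, show max 1 (d + 1 - j) = d + 1 - j by omega]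
  · intro j hj hjc
    rw [hzet j (by omega), DefectZeroRing.upperTerm, Φ.img_sup, PSub,
      show n + 2 + 1 - j = n + 1 - j + 2 by omega, hS, hT 1,
      show max 1 (d + 1 - j) = 1 by omega]
  · rw [show n + 2 - 1 = n + 1 by omega, show n + 2 - 2 = n by omega, hZ, hzet n le_rfl,
      Φ.img_upperTerm_top h]
    exact Φ.gam_two_eq
  · rw [hZtop, hxy, top_sup_eq]
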